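/- Let $q$ be a prime power, let $V$ be an $n$-dimensional vector space over the finite field $\mathbb F_q$, and let $1\le k\le n-1$. Let $X_V$ be the spherical building of $V$: its $p$-simplices ($p\ge -1$) are the chains $U_0\subsetneq\cdots\subsetneq U_p$ of linear subspaces with $0\ne U_0$ and $U_p\neq V$. Let $\mathfrak g$ be the local coefficient system on $X_V$ with $\mathfrak g(U_0\subsetneq\cdots\subsetneq U_p)=U_0$ and $\mathfrak g(\emptyset)=V$, whose connecting maps $\mathfrak g(\tau)\to\mathfrak g(\sigma)$ for $\sigma\subset\tau$ are the inclusions, and let $\wedge^k\mathfrak g$ be its $k$-th exterior power. Let $C_p(X_V;\wedge^k\mathfrak g)$ be the $\mathbb F_q$-space of formal sums $\sum_\sigma c(\sigma)\,\sigma$ over the $p$-simplices $\sigma$, with $c(\sigma)\in\wedge^k\mathfrak g(\sigma)$, with the boundary map $$\partial_p(c\,\sigma)=\sum_{i=0}^{p}(-1)^i\rho_i(c)\,\sigma_i ,$$ where $\sigma_i$ is obtained from $\sigma=(U_0\subsetneq\cdots\subsetneq U_p)$ by deleting $U_i$ and $\rho_i:\wedge^k\mathfrak g(\sigma)\to\wedge^k\mathfrak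 g(\sigma_i)$ is induced by inclusion; in particular $C_{-1}(X_V;\wedge^k\mathfrak g)=\wedge^kV$. Let $$\mathcal D^k(V)=\tilde H_{n-k-1}(X_V;\wedge^k\mathfrak g)=\ker\partial_{n-k-1}/\operatorname{im}\partial_{n-k}.$$ Then $$\dim_{\mathbb F_q}\mathcal D^k(V)=\sum_{1\le\alpha_1<\cdots<\alpha_{n-k}\le n-1}\ \prod_{j=1}^{n-k}\left(q^{\alpha_j}-1\right).$$ -/

import Mathlib

noncomputable section

open Module DirectSum
open scoped Classical

namespace Building

variable (F : Type*) [Field F] (V : Type*) [AddCommGroup V] [Module F V]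

/-- The vertices of the spherical building `X_V`: the linear subspaces `0 ≠ U ⊊ V`, ordered by
inclusion. -/
abbrev Vertex : Type _ := {U : Submodule F V // U ≠ ⊥ ∧ U ≠ ⊤}

/-- The simplices of `X_V` with `m` vertices (i.e. of dimension `m - 1`), written as strictly
increasing sequences `U₀ ⊊ ⋯ ⊊ U_{m-1}` of vertices. For `m = 0` this is the empty simplex. -/
abbrev Simplex (m : ℕ) : Type _ := Fin m ↪o Vertex F V

variable {F V}

/-- The face of `σ` obtained by deleting its `i`-th vertex (counted from `0`). -/
def Simplex.face {m : ℕ} (σ : Simplex F V (m + 1)) (i : Fin (m + 1)) : Simplex F V m :=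
  (Fin.succAboveOrderEmb i).trans σ

/-- The local system `𝔤` on objects: `𝔤(U₀ ⊊ ⋯ ⊊ U_{m-1}) = U₀` and `𝔤(∅) = V`. -/
def coeff : {m : ℕ} → Simplex F V m → Submodule F V
  | 0, _ => ⊤
  | _ + 1, σ => (σ 0).1

/-- Passing to a face can only enlarge the value of `𝔤`. -/
theorem coeff_le_face {m : ℕ} (σ : Simplex F V (m + 1)) (i : Fin (m + 1)) :
    coeff σ ≤ coeff (σ.face i) := by
  cases m with
  | zero => exact le_top
  | succ m => exact σ.monotone (Fin.zero_le _)

variable (F V)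

/-- The twisted chains `C_{m-1}(X_V; ⋀^k 𝔤)`: formal sums `∑ c(σ) σ` over the simplices `σ` with
`m` vertices, where `c(σ) ∈ ⋀^k 𝔤(σ)`. -/
def Chains (k m : ℕ) : Type _ := ⨁ σ : Simplex F V m, ⋀[F]^k (coeff σ)

instance (k m : ℕ) : AddCommGroup (Chains F V k m) :=
  inferInstanceAs (AddCommGroup (⨁ σ : Simplex F V m, ⋀[F]^k (coeff σ)))

instance (k m : ℕ) : Module F (Chains F V k m) :=
  inferInstanceAs (Module F (⨁ σ : Simplex F V m, ⋀[F]^k (coeff σ)))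

variable {F V} in
/-- The chain `c σ` supported on the simplex `σ`, as a linear function of `c ∈ ⋀^k 𝔤(σ)`. -/
def Chains.single (k : ℕ) {m : ℕ} (σ : Simplex F V m) : ⋀[F]^k (coeff σ) →ₗ[F] Chains F V k m :=
  DirectSum.lof F (Simplex F V m) (fun τ => ⋀[F]^k (coeff τ)) σ

/-- The boundary map `∂_m : C_m(X_V; ⋀^k 𝔤) → C_{m-1}(X_V; ⋀^k 𝔤)`, which sends `c σ` to
`∑ i, (-1)^i ρ(c) σ_i`, where `ρ` is induced by the inclusion `𝔤(σ) ⊆ 𝔤(σ_i)`. -/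
def boundary (k m : ℕ) : Chains F V k (m + 1) →ₗ[F] Chains F V k m :=
  DirectSum.toModule F _ _ fun σ =>
    ∑ i : Fin (m + 1), (-1 : F) ^ (i : ℕ) •
      (Chains.single k (σ.face i) ∘ₗ
        exteriorPower.map k (Submodule.inclusion (coeff_le_face σ i)))

theorem boundary_single (k m : ℕ) (σ : Simplex F V (m + 1)) (x : ⋀[F]^k (coeff σ)) :
    boundary F V k m (Chains.single k σ x) =
      ∑ i : Fin (m + 1), (-1 : F) ^ (i : ℕ) •
        Chains.single k (σ.face i)
          (exteriorPower.map k (Submodule.inclusion (coeff_le_face σ i)) x) := by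
  unfold boundary Chains.single
  erw [DirectSum.toModule_lof]
  simp only [LinearMap.sum_apply, LinearMap.smul_apply]
  rfl

/-- `∂ ∘ ∂ = 0`, so that the quotient below is the homology of a chain complex. -/
theorem boundary_boundary (k m : ℕ) :
    boundary F V k m ∘ₗ boundary F V k (m + 1) = 0 := by
  refine DirectSum.linearMap_ext F fun σ => LinearMap.ext fun x => ?_
  change boundary F V k m (boundary F V k (m + 1) (Chains.single k σ x)) = 0
  simp only [boundary_single, map_sum, map_smul, Finset.smul_sum, smul_smul]
  rw [← Finset.sum_product']
  refine Finset.sum_involution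
    (fun p _ => (p.1.succAbove p.2, p.2.predAbove p.1)) ?_ ?_ ?_ ?_
  · rintro ⟨i, j⟩ -
    have key : ∀ (τ τ' : Simplex F V m) (h : coeff σ ≤ coeff τ) (h' : coeff σ ≤ coeff τ'),
        τ = τ' → Chains.single k τ (exteriorPower.map k (Submodule.inclusion h) x) =
          Chains.single k τ' (exteriorPower.map k (Submodule.inclusion h') x) := by
      rintro τ _ h h' rfl; rfl
    have comp : ∀ (i : Fin (m + 2)) (j : Fin (m + 1)),
        exteriorPower.map k (Submodule.inclusion (coeff_le_face (σ.face i) j))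
          (exteriorPower.map k (Submodule.inclusion (coeff_le_face σ i)) x) =
        exteriorPower.map k (Submodule.inclusion
          ((coeff_le_face σ i).trans (coeff_le_face (σ.face i) j))) x := by
      intro i j
      rw [← LinearMap.comp_apply, ← exteriorPower.map_comp]
      rfl
    simp only [comp]
    rw [key ((σ.face (i.succAbove j)).face (j.predAbove i)) ((σ.face i).face j) _
      ((coeff_le_face σ i).trans (coeff_le_face (σ.face i) j)), ← add_smul]
    · convert zero_smul F _
      rcases Fin.lt_or_ge j.castSucc i with h | h
      · rw [Fin.succAbove_of_castSucc_lt _ _ h, Fin.predAbove_of_castSucc_lt _ _ h]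
        obtain ⟨i, rfl⟩ := Fin.exists_succ_eq.2 (Fin.ne_zero_of_lt h)
        simp [pow_succ, mul_comm]
      · rw [Fin.succAbove_of_le_castSucc _ _ h, Fin.predAbove_of_le_castSucc _ _ h]
        simp [pow_succ, mul_comm]
    · ext1 l
      exact congrArg σ (Fin.succAbove_succAbove_succAbove_predAbove i j l)
  · rintro ⟨i, j⟩ - - h
    exact Fin.succAbove_ne i j (congrArg Prod.fst h)
  · intro p _; simp
  · rintro ⟨i, j⟩ -
    simp [Fin.succAbove_succAbove_predAbove, Fin.predAbove_predAbove_succAbove]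

/-- The reduced homology `H̃_i(X_V; ⋀^k 𝔤) = ker ∂_i / im ∂_{i+1}` for `i ≥ 0`. The complex is
the augmented one: `∂_0` takes values in `C_{-1}(X_V; ⋀^k 𝔤) = ⋀^k V`. -/
abbrev ReducedHomology (k i : ℕ) : Type _ :=
  LinearMap.ker (boundary F V k i) ⧸
    (LinearMap.range (boundary F V k (i + 1))).submoduleOf (LinearMap.ker (boundary F V k i))

/-- `𝒟^k(V) = H̃_{n-k-1}(X_V; ⋀^k 𝔤)` with `n = dim V`, for `1 ≤ k ≤ n - 1`. -/
abbrev D (k : ℕ) : Type _ := ReducedHomology F V k (finrank F V - k - 1)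

end Building

end

/-!
The idea is to compute an Euler characteristic. The twisted chains of `X_V` vanish in degrees above
`n - k - 1`, and their reduced homology vanishes in degrees below `n - k - 1`, so
`(-1) ^ (n - k) dim 𝒟^k(V)` is the alternating sum of `dim ⋀^k U₀ = (dim U₀).choose k` over all
chains `U₀ ⊊ ⋯ ⊊ Uₚ` of proper subspaces, the empty chain contributing `n.choose k`.

Vanishing holds more generally for the coefficients `⋀^k (K ⊓ U₀)` on the half-open interval
`[A, A ⊔ K)` with `A` and `K` independent, where the zero subspace is harmless because `⋀^k 0 = 0`.
Contraction by a linear form `φ` with `φ A = 0` and `φ K ≠ 0` filters these coefficients by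
`⋀^k (K ⊓ ker φ ⊓ U₀)` and by a system supported on the subspaces not contained in `ker φ`. On the
first, intersecting with the hyperplane `(A ⊔ K) ⊓ ker φ` contracts the interval; on the second,
after removing the maximal elements `U` with `U ⊔ F ∙ e = A ⊔ K`, where `φ e = 1`, adding the line
`F ∙ e` retracts what is left onto `[A ⊔ F ∙ e, A ⊔ K)`, and both the links of the removed elements
and the retract are covered by induction.

By Philip Hall's theorem the alternating sum of `T ^ dim U₀` is the characteristic polynomial
`∏ i < n, (T - q ^ i)` of the lattice of subspaces; the alternating sum of `(dim U₀).choose k` is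
the coefficient of `T ^ k` after the substitution `T ↦ T + 1`, in which the factor `i = 0` is `T`.
-/

noncomputable section

open Module DirectSum
open scoped Classical

namespace Building

/-! ### Simplicial chains with coefficients -/

section CoefficientSystems

variable {P R M : Type*} [Ring R] [AddCommGroup M] [Module R M] {N : Finset P → Submodule R M}
  {m d : ℕ}

/-- The chains with `m` vertices of the coefficient system `N`: functions `c` supported on the sets
of cardinality `m` and with `c s ∈ N s`. -/
def chains (N : Finset P → Submodule R M) (m : ℕ) : Submodule R (Finset P → M) where
  carrier := {c | (∀ s, c s ∈ N s) ∧ ∀ s, s.card ≠ m → c s = 0}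
  zero_mem' := ⟨fun s => (N s).zero_mem, fun _ _ => rfl⟩
  add_mem' hc hd := ⟨fun s => (N s).add_mem (hc.1 s) (hd.1 s), fun s hs => by
    simp [hc.2 s hs, hd.2 s hs]⟩
  smul_mem' r _ hc := ⟨fun s => (N s).smul_mem r (hc.1 s), fun s hs => by simp [hc.2 s hs]⟩

theorem chains_mono {N' : Finset P → Submodule R M} (hN : ∀ s, N s ≤ N' s) (m : ℕ) :
    chains N m ≤ chains N' m :=
  fun _ hc => ⟨fun s => hN s (hc.1 s), hc.2⟩

theorem single_mem_chains [DecidableEq P] {s : Finset P} {x : M} (hx : x ∈ N s) :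
    Pi.single s x ∈ chains N s.card := by
  refine ⟨fun t => ?_, fun t ht => by rw [Pi.single_eq_of_ne]; rintro rfl; exact ht rfl⟩
  rcases eq_or_ne t s with rfl | h
  · rwa [Pi.single_eq_same]
  · rw [Pi.single_eq_of_ne h]
    exact zero_mem _

/-- The coefficient system of the link of `x`. -/
def link (x : P) (N : Finset P → Submodule R M) (s : Finset P) : Submodule R M :=
  if x ∈ s then ⊥ else N (insert x s)

/-- The restriction of the coefficient system to the simplices that avoid `x`. -/
def avoid (x : P) (N : Finset P → Submodule R M) (s : Finset P) : Submodule R M :=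
  if x ∈ s then ⊥ else N s

theorem avoid_le (x : P) (N : Finset P → Submodule R M) (s : Finset P) : avoid x N s ≤ N s := by
  rw [avoid]
  split_ifs
  exacts [bot_le, le_rfl]

variable [PartialOrder P]

/-- The sign with which the vertex `x` is deleted from `insert x s`. Vertices are compared in a
fixed linear extension of `P`, so that the simplicial identities hold for arbitrary finite sets of
vertices and not only for chains. -/
def vertexSign (x : P) (s : Finset P) : ℤ :=
  ∏ y ∈ s, if toLinearExtension y < toLinearExtension x then -1 else 1

theorem vertexSign_insert {x y : P} {s : Finset P} (hy : y ∉ s) :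
    vertexSign x (insert y s) =
      (if toLinearExtension y < toLinearExtension x then -1 else 1) * vertexSign x s :=
  Finset.prod_insert hy

theorem vertexSign_insert_self (x : P) (s : Finset P) :
    vertexSign x (insert x s) = vertexSign x s := by
  by_cases hx : x ∈ s
  · rw [Finset.insert_eq_of_mem hx]
  · simp [vertexSign_insert hx]

theorem vertexSign_mul_self (x : P) (s : Finset P) : vertexSign x s * vertexSign x s = 1 := by
  rw [vertexSign, ← Finset.prod_mul_distrib]
  exact Finset.prod_eq_one fun y _ => by split_ifs <;> norm_num

theorem vertexSign_insert_mul_vertexSign {x y : P} (hxy : x ≠ y) {s : Finset P} (hx : x ∉ s)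
    (hy : y ∉ s) :
    vertexSign x (insert y s) * vertexSign y s = -(vertexSign x s * vertexSign y (insert x s)) := by
  rw [vertexSign_insert hx, vertexSign_insert hy]
  have hne : (toLinearExtension x) ≠ toLinearExtension y := fun h => hxy h
  rcases hne.lt_or_gt with h | h <;> simp [h, h.not_gt]

theorem vertexSign_insert_mul_vertexSign_insert {x y : P} (hxy : x ≠ y) {s : Finset P}
    (hx : x ∉ s) (hy : y ∉ s) :
    vertexSign x (insert y s) * vertexSign y (insert x s) = -(vertexSign x s * vertexSign y s) := by
  rw [vertexSign_insert hx, vertexSign_insert hy]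
  have hne : (toLinearExtension x) ≠ toLinearExtension y := fun h => hxy h
  rcases hne.lt_or_gt with h | h <;> simp [h, h.not_gt]

variable (R)

/-- Deletion of the vertex `x`, on chains written as functions of the simplex: the value at `s` is
the signed contribution of the simplex `insert x s`. -/
def deleteVertex (x : P) : (Finset P → M) →ₗ[R] (Finset P → M) where
  toFun c s := if x ∈ s then 0 else vertexSign x s • c (insert x s)
  map_add' c d := by ext s; split_ifs <;> simp [*]
  map_smul' r c := by ext s; split_ifs <;> simp [*, smul_comm r]

/-- The cone with apex `x`: it adjoins `x` to every simplex not containing `x`. -/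
def coneOver (x : P) : (Finset P → M) →ₗ[R] (Finset P → M) where
  toFun c s := if x ∈ s then vertexSign x s • c (s.erase x) else 0
  map_add' c d := by ext s; split_ifs <;> simp [*]
  map_smul' r c := by ext s; split_ifs <;> simp [*, smul_comm r]

variable {R}

theorem deleteVertex_of_mem {x : P} {s : Finset P} (hx : x ∈ s) (c : Finset P → M) :
    deleteVertex R x c s = 0 :=
  if_pos hx

theorem deleteVertex_of_notMem {x : P} {s : Finset P} (hx : x ∉ s) (c : Finset P → M) :
    deleteVertex R x c s = vertexSign x s • c (insert x s) :=
  if_neg hx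

theorem coneOver_insert {x : P} {s : Finset P} (hx : x ∉ s) (c : Finset P → M) :
    coneOver R x c (insert x s) = vertexSign x s • c s := by
  simp [coneOver, hx, vertexSign_insert_self]

theorem coneOver_of_notMem {x : P} {s : Finset P} (hx : x ∉ s) (c : Finset P → M) :
    coneOver R x c s = 0 :=
  if_neg hx

theorem deleteVertex_single {x : P} {s : Finset P} (hx : x ∈ s) (y : M) :
    deleteVertex R x (Pi.single s y) = vertexSign x s • Pi.single (s.erase x) y := by
  ext t
  by_cases ht : x ∈ t
  · have hne : t ≠ s.erase x := fun h => s.notMem_erase x (h ▸ ht)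
    rw [deleteVertex_of_mem ht, Pi.smul_apply, Pi.single_eq_of_ne hne, smul_zero]
  rw [deleteVertex_of_notMem ht]
  by_cases h : insert x t = s
  · subst h
    rw [Finset.erase_insert ht, Pi.smul_apply, Pi.single_eq_same, Pi.single_eq_same,
      vertexSign_insert_self]
  · have hne : t ≠ s.erase x := fun h' => h (h' ▸ Finset.insert_erase hx)
    rw [Pi.smul_apply, Pi.single_eq_of_ne h, Pi.single_eq_of_ne hne, smul_zero, smul_zero]

theorem deleteVertex_single_of_notMem {x : P} {s : Finset P} (hx : x ∉ s) (y : M) :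
    deleteVertex R x (Pi.single s y) = 0 := by
  ext t
  by_cases ht : x ∈ t
  · exact deleteVertex_of_mem ht _
  · have hne : insert x t ≠ s := fun h => hx (h ▸ Finset.mem_insert_self x t)
    rw [deleteVertex_of_notMem ht, Pi.single_eq_of_ne hne, smul_zero, Pi.zero_apply]

theorem deleteVertex_deleteVertex_self (x : P) (c : Finset P → M) :
    deleteVertex R x (deleteVertex R x c) = 0 := by
  ext s
  by_cases hx : x ∈ s
  · simp [deleteVertex_of_mem hx]
  · simp [deleteVertex_of_notMem hx, deleteVertex_of_mem]

theorem deleteVertex_anticomm (x y : P) (c : Finset P → M) :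
    deleteVertex R x (deleteVertex R y c) = -deleteVertex R y (deleteVertex R x c) := by
  rcases eq_or_ne x y with rfl | hxy
  · rw [deleteVertex_deleteVertex_self, neg_zero]
  ext s
  by_cases hx : x ∈ s
  · by_cases hy : y ∈ s <;> simp [deleteVertex, hx, hy]
  by_cases hy : y ∈ s
  · simp [deleteVertex, hx, hy]
  have hx' : x ∉ insert y s := by simp [hx, hxy]
  have hy' : y ∉ insert x s := by simp [hy, hxy.symm]
  rw [Pi.neg_apply, deleteVertex_of_notMem hx, deleteVertex_of_notMem hy',
    deleteVertex_of_notMem hy, deleteVertex_of_notMem hx', smul_smul, smul_smul, ← neg_smul,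
    Finset.insert_comm, mul_comm (vertexSign y s), vertexSign_insert_mul_vertexSign hxy hx hy,
    neg_neg]

theorem deleteVertex_coneOver_self (x : P) (c : Finset P → M) :
    deleteVertex R x (coneOver R x c) + coneOver R x (deleteVertex R x c) = c := by
  ext s
  by_cases hx : x ∈ s
  · obtain ⟨t, hxt, rfl⟩ : ∃ t, x ∉ t ∧ insert x t = s :=
      ⟨s.erase x, s.notMem_erase x, Finset.insert_erase hx⟩
    simp [deleteVertex_of_mem, coneOver_insert hxt, deleteVertex_of_notMem hxt, smul_smul,
      vertexSign_mul_self]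
  · simp [deleteVertex_of_notMem hx, coneOver_insert hx, coneOver_of_notMem hx, smul_smul,
      vertexSign_mul_self]

theorem deleteVertex_coneOver {x y : P} (hxy : x ≠ y) (c : Finset P → M) :
    deleteVertex R x (coneOver R y c) = -coneOver R y (deleteVertex R x c) := by
  ext s
  by_cases hy : y ∈ s
  · obtain ⟨t, hyt, rfl⟩ : ∃ t, y ∉ t ∧ insert y t = s :=
      ⟨s.erase y, s.notMem_erase y, Finset.insert_erase hy⟩
    by_cases hx : x ∈ t
    · simp [deleteVertex_of_mem, coneOver_insert hyt, hx]
    have hx' : x ∉ insert y t := by simp [hx, hxy]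
    have hy' : y ∉ insert x t := by simp [hyt, hxy.symm]
    rw [Pi.neg_apply, deleteVertex_of_notMem hx', coneOver_insert hyt, deleteVertex_of_notMem hx,
      Finset.insert_comm, coneOver_insert hy', smul_smul, smul_smul, ← neg_smul,
      vertexSign_insert_mul_vertexSign_insert hxy hx hyt, mul_comm (vertexSign x t)]
  · rw [Pi.neg_apply, coneOver_of_notMem hy, neg_zero]
    by_cases hx : x ∈ s
    · exact deleteVertex_of_mem hx _
    · rw [deleteVertex_of_notMem hx, coneOver_of_notMem (by simp [hy, hxy.symm]), smul_zero]

theorem coneOver_mem_chains {N' : Finset P → Submodule R M} {x : P}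
    (hN : ∀ s, x ∉ s → N s ≤ N' (insert x s)) {c : Finset P → M} (hc : c ∈ chains N m) :
    coneOver R x c ∈ chains N' (m + 1) := by
  have hval : ∀ s, x ∈ s → coneOver R x c s = vertexSign x s • c (s.erase x) := fun s hs =>
    if_pos hs
  refine ⟨fun s => ?_, fun s hs => ?_⟩ <;> by_cases hx : x ∈ s
  · rw [hval s hx]
    refine zsmul_mem ?_ _
    simpa [Finset.insert_erase hx] using hN _ (s.notMem_erase x) (hc.1 (s.erase x))
  · simp [coneOver_of_notMem hx]
  · rw [hval s hx, hc.2, smul_zero]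
    rw [Finset.card_erase_of_mem hx]
    have := Finset.card_pos.2 ⟨x, hx⟩
    lia
  · exact coneOver_of_notMem hx c

theorem deleteVertex_mem_chains_link {x : P} {c : Finset P → M} (hc : c ∈ chains N (m + 1)) :
    deleteVertex R x c ∈ chains (link x N) m := by
  refine ⟨fun s => ?_, fun s hs => ?_⟩ <;> by_cases hx : x ∈ s
  · simp [deleteVertex_of_mem hx]
  · simpa [deleteVertex_of_notMem hx, link, hx] using zsmul_mem (hc.1 (insert x s)) _
  · exact deleteVertex_of_mem hx c
  · rw [deleteVertex_of_notMem hx, hc.2, smul_zero]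
    rw [Finset.card_insert_of_notMem hx]
    lia

theorem mem_chains_avoid {x : P} {c : Finset P → M} (hc : c ∈ chains N m)
    (hx : deleteVertex R x c = 0) : c ∈ chains (avoid x N) m := by
  refine ⟨fun s => ?_, hc.2⟩
  by_cases hxs : x ∈ s
  · suffices hzero : c s = 0 by simp [hzero]
    have herase := congrFun hx (s.erase x)
    rw [deleteVertex_of_notMem (s.notMem_erase x), Finset.insert_erase hxs] at herase
    simpa [smul_smul, vertexSign_mul_self] using congrArg (vertexSign x (s.erase x) • ·) herase
  · simpa [avoid, hxs] using hc.1 s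

variable [Fintype P]

variable (R) in
/-- The simplicial boundary map, on chains written as functions of the simplex. -/
def differential : (Finset P → M) →ₗ[R] (Finset P → M) := ∑ x, deleteVertex R x

theorem differential_eq_sum (c : Finset P → M) : differential R c = ∑ x, deleteVertex R x c :=
  LinearMap.sum_apply _ _ _

theorem differential_apply (c : Finset P → M) (s : Finset P) :
    differential R c s = ∑ x ∈ sᶜ, vertexSign x s • c (insert x s) := by
  rw [differential_eq_sum, Finset.sum_apply, ← Finset.sum_filter_add_sum_filter_not _ (· ∈ s),
    Finset.sum_eq_zero fun x hx => deleteVertex_of_mem (Finset.mem_filter.1 hx).2 c, zero_add]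
  exact Finset.sum_congr (by ext; simp) fun x hx =>
    deleteVertex_of_notMem (Finset.mem_compl.1 hx) c

theorem differential_single [h : DecidableEq P] (s : Finset P) (y : M) :
    differential R (Pi.single s y) = ∑ x ∈ s, vertexSign x s • Pi.single (s.erase x) y := by
  obtain rfl : h = fun a b => Classical.propDecidable (a = b) := Subsingleton.elim _ _
  rw [differential_eq_sum, ← Finset.sum_subset s.subset_univ fun x _ hx =>
    deleteVertex_single_of_notMem hx y]
  exact Finset.sum_congr rfl fun x hx => deleteVertex_single hx y

theorem deleteVertex_differential (x : P) (c : Finset P → M) :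
    deleteVertex R x (differential R c) = -differential R (deleteVertex R x c) := by
  simp only [differential_eq_sum, map_sum, ← Finset.sum_neg_distrib, deleteVertex_anticomm x]

theorem differential_differential (c : Finset P → M) : differential R (differential R c) = 0 := by
  rw [differential_eq_sum (differential R c)]
  simp only [differential_eq_sum, map_sum]
  rw [← Finset.sum_product']
  refine Finset.sum_involution (fun p _ => p.swap) (fun p _ => ?_) (fun p _ hp hswap => hp ?_)
    (fun p _ => Finset.mem_univ _) fun p _ => p.swap_swap
  · exact (congrArg (· + _) (deleteVertex_anticomm ..)).trans (neg_add_cancel _)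
  · rw [← congrArg Prod.fst hswap]
    exact deleteVertex_deleteVertex_self _ c

theorem differential_coneOver (x : P) (c : Finset P → M) :
    differential R (coneOver R x c) + coneOver R x (differential R c) = c := by
  simp only [differential_eq_sum, map_sum, ← Finset.sum_add_distrib]
  rw [Finset.sum_eq_single_of_mem x (Finset.mem_univ x) fun y _ hy => by
    rw [deleteVertex_coneOver hy, neg_add_cancel], deleteVertex_coneOver_self]

theorem differential_eq_zero_of_mem_chains_zero {c : Finset P → M} (hc : c ∈ chains N 0) :
    differential R c = 0 := by
  ext s
  rw [differential_apply]
  exact Finset.sum_eq_zero fun x _ => by rw [hc.2 _ (by simp), smul_zero]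

/-- The cycles with `m` vertices of the coefficient system `N`. -/
def cycles (N : Finset P → Submodule R M) (m : ℕ) : Submodule R (Finset P → M) :=
  chains N m ⊓ LinearMap.ker (differential R)

/-- The reduced homology of the coefficient system `N` vanishes on simplices with fewer than `d`
vertices, that is, in dimensions below `d - 1`. -/
def ExactBelow (N : Finset P → Submodule R M) (d : ℕ) : Prop :=
  ∀ m < d, cycles N m ≤ (chains N (m + 1)).map (differential R)

theorem ExactBelow.mono {e : ℕ} (hN : ExactBelow N d) (hed : e ≤ d) : ExactBelow N e :=
  fun m hm => hN m (hm.trans_le hed)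

theorem ExactBelow.exists_differential_eq (hN : ExactBelow N d) (hm : m < d) {z : Finset P → M}
    (hz : z ∈ chains N m) (hdz : differential R z = 0) :
    ∃ w ∈ chains N (m + 1), differential R w = z :=
  hN m hm ⟨hz, hdz⟩

theorem differential_mem_chains (hN : Antitone N) {c : Finset P → M} (hc : c ∈ chains N (m + 1)) :
    differential R c ∈ chains N m := by
  refine ⟨fun s => ?_, fun s hs => ?_⟩ <;> rw [differential_apply]
  · exact sum_mem fun x _ => zsmul_mem (hN (s.subset_insert x) (hc.1 _)) _
  · refine Finset.sum_eq_zero fun x hx => ?_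
    rw [hc.2, smul_zero]
    rw [Finset.card_insert_of_notMem (Finset.mem_compl.1 hx)]
    lia

/-- `x` is a cone point of `N`, and the cone over `x` is a contracting homotopy. -/
theorem exactBelow_of_le_insert {x : P} (hN : ∀ s, N s ≤ N (insert x s)) (d : ℕ) :
    ExactBelow N d := by
  rintro m - z ⟨hz, hdz⟩
  refine ⟨coneOver R x z, coneOver_mem_chains (fun s _ => hN s) hz, ?_⟩
  simpa [LinearMap.mem_ker.1 hdz] using differential_coneOver (R := R) x z

/-- The vertex `x` of a cycle can be removed by coning off a chain of the link whose boundary is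
the link of `x` in the cycle. -/
theorem ExactBelow.of_avoid_of_link {x : P} (hN : Antitone N)
    (havoid : ExactBelow (avoid x N) (d + 1)) (hlink : ExactBelow (link x N) d) :
    ExactBelow N (d + 1) := by
  rintro m hm z ⟨hz, hdz⟩
  rw [SetLike.mem_coe, LinearMap.mem_ker] at hdz
  suffices ∃ u ∈ chains N (m + 1), z - differential R u ∈ chains (avoid x N) m by
    obtain ⟨u, hu, hzu⟩ := this
    obtain ⟨v, hv, hdv⟩ := havoid.exists_differential_eq hm hzu (by
      rw [map_sub, hdz, differential_differential, sub_zero])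
    refine ⟨v + u, add_mem (chains_mono (avoid_le x N) _ hv) hu, ?_⟩
    rw [map_add, hdv, sub_add_cancel]
  rcases m with _ | m
  · refine ⟨0, zero_mem _, mem_chains_avoid (by simpa using hz) ?_⟩
    ext s
    by_cases hx : x ∈ s
    · exact deleteVertex_of_mem hx _
    · simp [deleteVertex_of_notMem hx, hz.2 (insert x s)]
  · obtain ⟨w, hw, hdw⟩ := hlink.exists_differential_eq (Nat.lt_of_succ_lt_succ hm)
      (deleteVertex_mem_chains_link (x := x) hz) (by
        rw [← neg_eq_zero, ← deleteVertex_differential, hdz, map_zero])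
    have hxw : deleteVertex R x w = 0 := by
      ext s
      by_cases hx : x ∈ s
      · exact deleteVertex_of_mem hx _
      · have hmem := hw.1 (insert x s)
        simp only [link, Finset.mem_insert_self, if_true, Submodule.mem_bot] at hmem
        simp [deleteVertex_of_notMem hx, hmem]
    refine ⟨-coneOver R x w, neg_mem (coneOver_mem_chains (fun s hx => by simp [link, hx]) hw),
      mem_chains_avoid (sub_mem hz (differential_mem_chains hN
        (neg_mem (coneOver_mem_chains (fun s hx => by simp [link, hx]) hw)))) ?_⟩
    have hcone := deleteVertex_coneOver_self (R := R) x w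
    rw [hxw, map_zero, add_zero] at hcone
    rw [map_neg, sub_neg_eq_add, map_add, deleteVertex_differential, hcone, hdw, add_neg_cancel]

end CoefficientSystems

section ShortExactSequences

variable {P R M M' : Type*} [Ring R] [AddCommGroup M] [Module R M]
  [AddCommGroup M'] [Module R M'] {N : Finset P → Submodule R M} {m d : ℕ}

theorem map_compLeft_chains (f : M →ₗ[R] M') (N : Finset P → Submodule R M) (m : ℕ) :
    (chains N m).map (f.compLeft (Finset P)) = chains (fun s => (N s).map f) m := by
  apply le_antisymm
  · rintro _ ⟨c, hc, rfl⟩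
    exact ⟨fun s => Submodule.mem_map_of_mem (hc.1 s), fun s hs => by simp [hc.2 s hs]⟩
  · intro c hc
    choose b hb hbc using hc.1
    refine ⟨fun s => if s.card = m then b s else 0, ⟨fun s => ?_, fun s hs => if_neg hs⟩, ?_⟩
    · dsimp only
      split_ifs
      exacts [hb s, zero_mem _]
    · ext s
      by_cases hs : s.card = m <;> simp [hs, hbc, hc.2]

theorem mem_chains_inf_ker {f : M →ₗ[R] M'} {c : Finset P → M} (hc : c ∈ chains N m)
    (hf : f.compLeft (Finset P) c = 0) : c ∈ chains (fun s => N s ⊓ LinearMap.ker f) m :=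
  ⟨fun s => ⟨hc.1 s, congrFun hf s⟩, hc.2⟩

theorem compLeft_eq_zero_of_mem_chains {f : M →ₗ[R] M'} {c : Finset P → M}
    (hc : c ∈ chains (fun s => N s ⊓ LinearMap.ker f) m) : f.compLeft (Finset P) c = 0 :=
  funext fun s => (hc.1 s).2

variable [PartialOrder P] [Fintype P]

theorem differential_compLeft (f : M →ₗ[R] M') (c : Finset P → M) :
    differential R (f.compLeft (Finset P) c) = f.compLeft (Finset P) (differential R c) := by
  ext s
  simp [differential_apply]

theorem exactBelow_of_ker_of_map (f : M →ₗ[R] M') (hN : Antitone N)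
    (hker : ExactBelow (fun s => N s ⊓ LinearMap.ker f) d)
    (hmap : ExactBelow (fun s => (N s).map f) d) : ExactBelow N d := by
  rintro m hm z ⟨hz, hdz⟩
  rw [SetLike.mem_coe, LinearMap.mem_ker] at hdz
  obtain ⟨_, hw, hdw⟩ := hmap.exists_differential_eq hm
    (map_compLeft_chains f N m ▸ Submodule.mem_map_of_mem hz)
    (by rw [differential_compLeft, hdz, map_zero])
  rw [← map_compLeft_chains] at hw
  obtain ⟨w, hw, rfl⟩ := hw
  rw [differential_compLeft] at hdw
  obtain ⟨v, hv, hdv⟩ := hker.exists_differential_eq hm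
    (mem_chains_inf_ker (f := f) (sub_mem hz (differential_mem_chains hN hw))
      (by rw [map_sub, hdw, sub_self]))
    (by rw [map_sub, hdz, differential_differential, sub_zero])
  refine ⟨v + w, add_mem (chains_mono (fun s => inf_le_left) _ hv) hw, ?_⟩
  rw [map_add, hdv, sub_add_cancel]

theorem ExactBelow.map (f : M →ₗ[R] M') (hN : Antitone N) (h : ExactBelow N d)
    (hker : ExactBelow (fun s => N s ⊓ LinearMap.ker f) d) :
    ExactBelow (fun s => (N s).map f) d := by
  rintro m hm _ ⟨hz, hdz⟩
  rw [← map_compLeft_chains] at hz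
  obtain ⟨z, hz, rfl⟩ := hz
  rw [SetLike.mem_coe, LinearMap.mem_ker, differential_compLeft] at hdz
  suffices ∃ v ∈ chains (fun s => N s ⊓ LinearMap.ker f) m, differential R v = differential R z by
    obtain ⟨v, hv, hdv⟩ := this
    obtain ⟨w, hw, hdw⟩ := h.exists_differential_eq hm
      (sub_mem hz (chains_mono (fun s => inf_le_left) _ hv)) (by rw [map_sub, hdv, sub_self])
    refine ⟨_, map_compLeft_chains f N (m + 1) ▸ Submodule.mem_map_of_mem hw, ?_⟩
    rw [differential_compLeft, hdw, map_sub, compLeft_eq_zero_of_mem_chains hv, sub_zero]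
  rcases m with _ | m
  · exact ⟨0, zero_mem _, by rw [map_zero, differential_eq_zero_of_mem_chains_zero hz]⟩
  · exact hker.exists_differential_eq (Nat.lt_of_succ_lt hm)
      (mem_chains_inf_ker (differential_mem_chains hN hz) hdz) (differential_differential z)

end ShortExactSequences

section EulerCharacteristic

variable {P F M : Type*} [Field F] [AddCommGroup M] [Module F M] {N : Finset P → Submodule F M}

theorem finrank_map_add_finrank_inf_ker {M' : Type*} [AddCommGroup M'] [Module F M']
    (f : M →ₗ[F] M') (S : Submodule F M) [Module.Finite F S] :
    finrank F (S.map f) + finrank F ↥(S ⊓ LinearMap.ker f) = finrank F S := by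
  rw [← (f.domRestrict S).finrank_range_add_finrank_ker, LinearMap.range_domRestrict,
    LinearMap.ker_domRestrict, ← (Submodule.comapSubtypeEquivOfLe inf_le_left).finrank_eq,
    Submodule.comap_inf, Submodule.comap_subtype_self, top_inf_eq]

variable (N) in
/-- A chain with `m` vertices amounts to a family of coefficients on the sets of cardinality `m`. -/
def chainsEquiv (m : ℕ) : chains N m ≃ₗ[F] ∀ s : {s : Finset P // s.card = m}, N s.1 where
  toFun c s := ⟨c.1 s.1, c.2.1 s.1⟩
  map_add' _ _ := rfl
  map_smul' _ _ := rfl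
  invFun b := ⟨fun s => if hs : s.card = m then (b ⟨s, hs⟩ : M) else 0, fun s => by
    dsimp only
    split_ifs with hs
    exacts [(b ⟨s, hs⟩).2, zero_mem _], fun s hs => dif_neg hs⟩
  left_inv c := by
    ext s
    by_cases hs : s.card = m <;> simp [hs, c.2.2]
  right_inv b := by
    ext s
    simp [s.2]

variable [∀ s, Module.Finite F (N s)]

instance finite_chains [Finite P] (m : ℕ) : Module.Finite F (chains N m) :=
  let _ := Fintype.ofFinite P
  Module.Finite.equiv (chainsEquiv N m).symm

variable [Fintype P]

theorem finrank_chains (m : ℕ) :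
    finrank F (chains N m) = ∑ s : Finset P with s.card = m, finrank F (N s) := by
  rw [(chainsEquiv N m).finrank_eq, Module.finrank_pi_fintype,
    Finset.sum_subtype _ (p := fun s : Finset P => s.card = m) (by simp)]

variable [PartialOrder P]

theorem ExactBelow.finrank_chains_succ {d m : ℕ} (hN : Antitone N) (h : ExactBelow N d)
    (hm : m < d) :
    finrank F (chains N (m + 1)) = finrank F (cycles N m) + finrank F (cycles N (m + 1)) := by
  have hmap : (chains N (m + 1)).map (differential F) = cycles N m := by
    refine le_antisymm ?_ (h m hm)
    rintro _ ⟨c, hc, rfl⟩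
    exact ⟨differential_mem_chains hN hc, differential_differential c⟩
  rw [← finrank_map_add_finrank_inf_ker (differential F), hmap]
  rfl

theorem ExactBelow.finrank_cycles {d : ℕ} (hN : Antitone N) (h : ExactBelow N d) :
    (-1 : ℤ) ^ d * finrank F (cycles N d) =
      ∑ m ∈ Finset.range (d + 1), (-1 : ℤ) ^ m * finrank F (chains N m) := by
  induction d with
  | zero =>
    have hzero : cycles N 0 = chains N 0 :=
      inf_eq_left.2 fun _ => differential_eq_zero_of_mem_chains_zero
    rw [hzero]
    simp
  | succ d ih =>
    rw [Finset.sum_range_succ, ← ih (h.mono d.le_succ), h.finrank_chains_succ hN d.lt_succ_self]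
    push_cast
    ring

/-- The Euler characteristic of a complex whose homology is concentrated in the top degree. -/
theorem ExactBelow.finrank_cycles_top {d : ℕ} (hN : Antitone N) (h : ExactBelow N d)
    (hd : ∀ s, d < s.card → N s = ⊥) :
    (-1 : ℤ) ^ d * finrank F (cycles N d) = ∑ s, (-1 : ℤ) ^ s.card * finrank F (N s) := by
  have hsupp : ∀ s : Finset P, (-1 : ℤ) ^ s.card * finrank F (N s) ≠ 0 →
      s.card ∈ Finset.range (d + 1) := by
    intro s hs
    by_contra! hcard
    rw [Finset.mem_range, not_lt] at hcard
    rw [hd s hcard] at hs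
    simp at hs
  rw [h.finrank_cycles hN, ← Finset.sum_filter_of_ne fun s _ => hsupp s,
    ← Finset.sum_fiberwise_eq_sum_filter]
  refine Finset.sum_congr rfl fun m _ => ?_
  rw [finrank_chains, Nat.cast_sum, Finset.mul_sum]
  exact Finset.sum_congr rfl fun s hs => by rw [(Finset.mem_filter.1 hs).2]

end EulerCharacteristic

/-! ### Coefficient systems on order complexes -/

section OrderComplexes

variable {P R M : Type*} [Ring R] [AddCommGroup M] [Module R M]

section OrderCoeff

variable [SemilatticeInf P] [OrderTop P] {S : Set P} {L : P → Submodule R M}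

/-- The coefficient system on the order complex of `S` whose value at a chain is the value of `L`
at the least element of the chain, and `L ⊤` at the empty chain. -/
def orderCoeff (S : Set P) (L : P → Submodule R M) (s : Finset P) : Submodule R M :=
  if IsChain (· ≤ ·) (s : Set P) ∧ ↑s ⊆ S then L (s.inf id) else ⊥

theorem orderCoeff_of_isChain {s : Finset P} (hs : IsChain (· ≤ ·) (s : Set P)) (hS : ↑s ⊆ S) :
    orderCoeff S L s = L (s.inf id) :=
  if_pos ⟨hs, hS⟩

theorem orderCoeff_le {s : Finset P} {Q : Submodule R M}
    (h : IsChain (· ≤ ·) (s : Set P) → ↑s ⊆ S → L (s.inf id) ≤ Q) : orderCoeff S L s ≤ Q := by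
  rw [orderCoeff]
  split_ifs with hs
  exacts [h hs.1 hs.2, bot_le]

theorem antitone_orderCoeff (hL : Monotone L) : Antitone (orderCoeff S L) := fun s t hst =>
  orderCoeff_le fun ht hS => by
    rw [orderCoeff_of_isChain (ht.mono (mod_cast hst)) (subset_trans (mod_cast hst) hS)]
    exact hL (Finset.inf_mono hst)

theorem orderCoeff_le_insert {s : Finset P} {v : P} (hv : v ∈ S)
    (hcomp : IsChain (· ≤ ·) (s : Set P) → ↑s ⊆ S → ∀ w ∈ s, w ≤ v ∨ v ≤ w)
    (hL : L (s.inf id) ≤ L (s.inf id ⊓ v)) :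
    orderCoeff S L s ≤ orderCoeff S L (insert v s) := by
  refine orderCoeff_le fun hs hS => ?_
  rw [orderCoeff_of_isChain]
  · simpa [inf_comm] using hL
  · rw [Finset.coe_insert]
    exact hs.insert fun w hw _ => (hcomp hs hS w hw).symm
  · simpa [Set.insert_subset_iff, hv] using hS

theorem avoid_orderCoeff (u : P) (S : Set P) (L : P → Submodule R M) :
    avoid u (orderCoeff S L) = orderCoeff (S \ {u}) L := by
  ext1 s
  by_cases hu : u ∈ s <;> simp [avoid, orderCoeff, hu, Set.subset_sdiff]

theorem link_orderCoeff_of_maximal {u : P} (hu : u ∈ S) (hmax : ∀ w ∈ S, ¬u < w) :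
    link u (orderCoeff S L) = orderCoeff {w ∈ S | w < u} fun U => L (u ⊓ U) := by
  ext1 s
  by_cases hus : u ∈ s
  · have hnot : ¬(s : Set P) ⊆ {w ∈ S | w < u} := fun h => (h hus).2.false
    simp [link, orderCoeff, hus, hnot]
  have hiff : (IsChain (· ≤ ·) (↑(insert u s) : Set P) ∧ ↑(insert u s) ⊆ S) ↔
      IsChain (· ≤ ·) (s : Set P) ∧ ↑s ⊆ {w ∈ S | w < u} := by
    rw [Finset.coe_insert]
    refine ⟨fun ⟨hs, hS⟩ => ⟨hs.mono (Set.subset_insert _ _), fun w hw => ?_⟩,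
      fun ⟨hs, hS⟩ => ⟨hs.insert fun w hw _ => Or.inr (hS hw).2.le,
        Set.insert_subset hu fun w hw => (hS hw).1⟩⟩
    have hwu : w ≠ u := fun h => hus (h ▸ hw)
    have hwS : w ∈ S := hS (Set.mem_insert_of_mem _ hw)
    rcases hs (Set.mem_insert_of_mem _ hw) (Set.mem_insert _ _) hwu with h | h
    · exact ⟨hwS, h.lt_of_ne hwu⟩
    · exact absurd (h.lt_of_ne hwu.symm) (hmax w hwS)
  simp only [link, orderCoeff, hus, if_false, hiff, Finset.inf_insert, id]

theorem inf_id_eq_top_or_mem {s : Finset P} (hs : IsChain (· ≤ ·) (s : Set P)) :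
    s.inf id = ⊤ ∨ s.inf id ∈ s := by
  refine Finset.inf_mem (insert ⊤ (s : Set P)) (Set.mem_insert _ _) (fun x hx y hy => ?_) s id
    fun x hx => Set.mem_insert_of_mem _ hx
  rcases (hs.insert fun _ _ _ => Or.inr le_top).total hx hy with h | h
  · rwa [inf_eq_left.2 h]
  · rwa [inf_eq_right.2 h]

theorem orderCoeff_inf (S : Set P) (L : P → Submodule R M) (Q : Submodule R M) :
    (fun s => orderCoeff S L s ⊓ Q) = orderCoeff S fun U => L U ⊓ Q := by
  ext1 s
  simp only [orderCoeff]
  split_ifs <;> simp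

theorem map_orderCoeff {M' : Type*} [AddCommGroup M'] [Module R M'] (f : M →ₗ[R] M') (S : Set P)
    (L : P → Submodule R M) :
    (fun s => (orderCoeff S L s).map f) = orderCoeff S fun U => (L U).map f := by
  ext1 s
  simp only [orderCoeff]
  split_ifs <;> simp

theorem orderCoeff_ite_bot (S : Set P) (L : P → Submodule R M) {p : P → Prop}
    (hp : ∀ U W, U ≤ W → p W → p U) (htop : ¬p ⊤) :
    orderCoeff S (fun U => if p U then ⊥ else L U) = orderCoeff {U ∈ S | ¬p U} L := by
  ext1 s
  have hiff (hs : IsChain (· ≤ ·) (s : Set P)) : ¬p (s.inf id) ↔ ∀ U ∈ s, ¬p U := by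
    refine ⟨fun h U hU hpU => h (hp _ U (Finset.inf_le (f := id) hU) hpU), fun h => ?_⟩
    rcases inf_id_eq_top_or_mem hs with h' | h'
    exacts [h' ▸ htop, h _ h']
  by_cases hs : IsChain (· ≤ ·) (s : Set P)
  · have hsub : ↑s ⊆ {U ∈ S | ¬p U} ↔ ↑s ⊆ S ∧ ¬p (s.inf id) := by
      rw [hiff hs]
      exact Set.subset_inter_iff
    by_cases h : p (s.inf id) <;> simp [orderCoeff, hs, hsub, h]
  · simp [orderCoeff, hs]

variable [Fintype P]

/-- The vertex `u` is dominated by `v`: the link of `u` is a cone with apex `v`. -/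
theorem ExactBelow.of_dominated {d : ℕ} {u v : P} (hL : Monotone L) (hv : v ∈ S) (hvu : v ≠ u)
    (hcomp : ∀ w ∈ S, w ≤ u ∨ u ≤ w → w ≤ v ∨ v ≤ w) (hLv : ∀ U ≤ u, L U ≤ L (U ⊓ v))
    (h : ExactBelow (orderCoeff (S \ {u}) L) d) : ExactBelow (orderCoeff S L) d := by
  rcases d with _ | d
  · exact fun m hm => absurd hm m.not_lt_zero
  refine .of_avoid_of_link (x := u) (antitone_orderCoeff hL) (avoid_orderCoeff u S L ▸ h)
    (exactBelow_of_le_insert (x := v) (fun s => ?_) d)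
  by_cases hu : u ∈ s
  · simp [link, hu]
  have hu' : u ∉ insert v s := by simp [hu, hvu.symm]
  simp only [link, hu, hu', if_false]
  rw [Finset.insert_comm]
  refine orderCoeff_le_insert hv (fun hs hS w hw => hcomp w (hS hw) ?_) (hLv _ (by simp))
  rcases eq_or_ne w u with rfl | hwu
  exacts [Or.inl le_rfl, hs hw (by simp) hwu]

/-- Quillen's contraction `u ≥ u ⊓ c ≤ c`. -/
theorem exactBelow_of_inf_mem {c : P} (hL : Monotone L) (hc : c ∈ S)
    (hinf : ∀ u ∈ S, u ⊓ c ∈ S) (hLc : ∀ U, L U ≤ L (U ⊓ c)) (d : ℕ) :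
    ExactBelow (orderCoeff S L) d := by
  induction S using WellFoundedLT.induction with | ind S ih =>
  by_cases hle : ∀ u ∈ S, u ≤ c
  · refine exactBelow_of_le_insert (x := c) (fun s => ?_) d
    exact orderCoeff_le_insert hc (fun _ hS w hw => Or.inl (hle w (hS hw))) (hLc _)
  push Not at hle
  obtain ⟨u, ⟨huS, huc⟩, hmin⟩ := (Set.toFinite {u | u ∈ S ∧ ¬u ≤ c}).exists_minimal hle
  have hne : ∀ w, w ⊓ c ≠ u := fun w h => huc (h ▸ inf_le_right)
  refine .of_dominated hL (hinf u huS) (hne u) (fun w hw => ?_) (fun U hU => ?_)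
    (ih (S \ {u}) (by simpa using huS) ⟨hc, fun h => huc h.ge⟩
      fun w hw => ⟨hinf w hw.1, hne w⟩)
  · rintro (h | h)
    · by_cases hwc : w ≤ c
      · exact Or.inl (le_inf h hwc)
      · exact Or.inr (inf_le_left.trans (hmin ⟨hw, hwc⟩ h))
    · exact Or.inr (inf_le_left.trans h)
  · rw [← inf_assoc, inf_eq_left.2 hU]
    exact hLc U

/-- Maximal elements of `S` can be removed one at a time, since they are pairwise incomparable. -/
theorem ExactBelow.of_maximal {d : ℕ} {T : Set P} (hL : Monotone L) (hTS : T ⊆ S)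
    (hmax : ∀ u ∈ T, ∀ w ∈ S, ¬u < w) (hdiff : ExactBelow (orderCoeff (S \ T) L) (d + 1))
    (hlink : ∀ u ∈ T, ExactBelow (orderCoeff {w ∈ S | w < u} fun U => L (u ⊓ U)) d) :
    ExactBelow (orderCoeff S L) (d + 1) := by
  induction T, T.toFinite using Set.Finite.induction_on generalizing S with
  | empty => simpa using hdiff
  | @insert u T hu _ ih =>
    have huS : u ∈ S := hTS (Set.mem_insert u T)
    refine .of_avoid_of_link (x := u) (antitone_orderCoeff hL) ?_ ?_
    · rw [avoid_orderCoeff]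
      refine ih (fun w hw => ⟨hTS (Set.mem_insert_of_mem u hw), fun h => hu (h ▸ hw)⟩)
        (fun w hw x hx => hmax w (Set.mem_insert_of_mem u hw) x hx.1) ?_ fun w hw => ?_
      · rwa [Set.sdiff_sdiff, Set.singleton_union]
      · have hset : {x ∈ S \ {u} | x < w} = {x ∈ S | x < w} := by
          ext x
          refine ⟨fun h => ⟨h.1.1, h.2⟩, fun h => ⟨⟨h.1, ?_⟩, h.2⟩⟩
          rintro rfl
          exact hmax x (Set.mem_insert x T) w (hTS (Set.mem_insert_of_mem x hw)) h.2
        rw [hset]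
        exact hlink w (Set.mem_insert_of_mem u hw)
    · rw [link_orderCoeff_of_maximal huS (hmax u (Set.mem_insert u T))]
      exact hlink u (Set.mem_insert u T)

end OrderCoeff

variable [Lattice P] [OrderTop P] [Fintype P] {S : Set P} {L : P → Submodule R M}

/-- Quillen's contraction `u ≤ u ⊔ c` onto the elements above `c`. -/
theorem ExactBelow.of_sup_mem {d : ℕ} {c : P} (hL : Monotone L) (hsup : ∀ u ∈ S, u ⊔ c ∈ S)
    (h : ExactBelow (orderCoeff {u ∈ S | c ≤ u} L) d) : ExactBelow (orderCoeff S L) d := by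
  induction S using WellFoundedLT.induction with | ind S ih =>
  by_cases hle : ∀ u ∈ S, c ≤ u
  · rwa [show {u ∈ S | c ≤ u} = S from Set.sep_eq_self_iff_mem_true.2 hle] at h
  push Not at hle
  obtain ⟨u, ⟨huS, huc⟩, hmax⟩ := (Set.toFinite {u | u ∈ S ∧ ¬c ≤ u}).exists_maximal hle
  have hne : ∀ w, w ⊔ c ≠ u := fun w h => huc (h ▸ le_sup_right)
  refine .of_dominated hL (hsup u huS) (hne u) (fun w hw => ?_) (fun U hU => ?_)
    (ih (S \ {u}) (by simpa using huS) (fun w hw => ⟨hsup w hw.1, hne w⟩) ?_)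
  · rintro (h | h)
    · exact Or.inl (h.trans le_sup_left)
    · by_cases hwc : c ≤ w
      · exact Or.inr (sup_le h hwc)
      · exact Or.inl ((hmax ⟨hw, hwc⟩ h).trans le_sup_left)
  · rw [inf_eq_left.2 (hU.trans le_sup_left)]
  · convert h using 2
    ext x
    refine ⟨fun hx => ⟨hx.1.1, hx.2⟩, fun hx => ⟨⟨hx.1, ?_⟩, hx.2⟩⟩
    rintro rfl
    exact huc hx.2

end OrderComplexes

/-! ### Exterior powers of subspaces and the exactness theorem -/

section ExteriorPowers

variable {F V : Type*} [Field F] [AddCommGroup V] [Module F V] {k : ℕ} {U W : Submodule F V}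
  {φ : Dual F V}

/-- The image of `⋀^k U` in the exterior algebra of the ambient space `V`. -/
def extPow (k : ℕ) (U : Submodule F V) : Submodule F (ExteriorAlgebra F V) :=
  U.map (ExteriorAlgebra.ι F) ^ k

theorem extPow_zero (U : Submodule F V) : extPow 0 U = 1 :=
  pow_zero _

theorem extPow_succ (k : ℕ) (U : Submodule F V) :
    extPow (k + 1) U = U.map (ExteriorAlgebra.ι F) * extPow k U :=
  pow_succ' _ _

theorem extPow_succ_bot (k : ℕ) : extPow (k + 1) (⊥ : Submodule F V) = ⊥ := by
  rw [extPow_succ, Submodule.map_bot, Submodule.bot_mul]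

theorem extPow_mono (k : ℕ) : Monotone (extPow k : Submodule F V → _) :=
  fun _ _ h => pow_le_pow_left' (Submodule.map_mono h) k

theorem ι_mul_mem_extPow {u : V} (hu : u ∈ U) {x : ExteriorAlgebra F V} (hx : x ∈ extPow k U) :
    ExteriorAlgebra.ι F u * x ∈ extPow (k + 1) U :=
  extPow_succ k U ▸ Submodule.mul_mem_mul (Submodule.mem_map_of_mem hu) hx

theorem map_ι_mul_map_ι_le (U W : Submodule F V) :
    U.map (ExteriorAlgebra.ι F) * W.map (ExteriorAlgebra.ι F) ≤
      W.map (ExteriorAlgebra.ι F) * U.map (ExteriorAlgebra.ι F) := by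
  rw [Submodule.mul_le]
  rintro _ ⟨u, hu, rfl⟩ _ ⟨w, hw, rfl⟩
  rw [eq_neg_of_add_eq_zero_left (ExteriorAlgebra.ι_add_mul_swap u w)]
  exact neg_mem (Submodule.mul_mem_mul (Submodule.mem_map_of_mem hw) (Submodule.mem_map_of_mem hu))

theorem extPow_succ_sup_span_le (k : ℕ) (W : Submodule F V) (e : V) :
    extPow (k + 1) (W ⊔ F ∙ e) ≤
      extPow (k + 1) W ⊔ (F ∙ e).map (ExteriorAlgebra.ι F) * extPow k W := by
  have hsq : (F ∙ e).map (ExteriorAlgebra.ι F) * (F ∙ e).map (ExteriorAlgebra.ι F) = ⊥ := by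
    simp [Submodule.map_span, Submodule.span_mul_span]
  induction k with
  | zero => simp [extPow, Submodule.map_sup]
  | succ k ih =>
    rw [extPow_succ, Submodule.map_sup]
    refine (mul_le_mul' le_rfl ih).trans ?_
    rw [Submodule.sup_mul, Submodule.mul_sup, Submodule.mul_sup, ← mul_assoc, ← mul_assoc, hsq,
      Submodule.bot_mul, sup_bot_eq, ← extPow_succ, sup_assoc]
    refine sup_le_sup_left (sup_le ?_ le_rfl) _
    rw [extPow_succ k, ← mul_assoc]
    exact mul_le_mul' (map_ι_mul_map_ι_le W _) le_rfl

/-- Contraction of the exterior algebra by a linear form. -/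
def contract (φ : Dual F V) : ExteriorAlgebra F V →ₗ[F] ExteriorAlgebra F V :=
  CliffordAlgebra.contractLeft φ

theorem contract_ι_mul (φ : Dual F V) (v : V) (x : ExteriorAlgebra F V) :
    contract φ (ExteriorAlgebra.ι F v * x) = φ v • x - ExteriorAlgebra.ι F v * contract φ x :=
  CliffordAlgebra.contractLeft_ι_mul φ v x

theorem extPow_le_ker_contract (hU : U ≤ LinearMap.ker φ) (k : ℕ) :
    extPow k U ≤ LinearMap.ker (contract φ) := by
  induction k with
  | zero =>
    rw [extPow_zero, Submodule.one_le]
    exact CliffordAlgebra.contractLeft_one (Q := (0 : QuadraticForm F V)) φ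
  | succ k ih =>
    rw [extPow_succ, Submodule.mul_le]
    rintro _ ⟨u, hu, rfl⟩ x hx
    rw [LinearMap.mem_ker, contract_ι_mul, LinearMap.mem_ker.1 (hU hu),
      LinearMap.mem_ker.1 (ih hx), zero_smul, mul_zero, sub_zero]

theorem contract_ι_mul_of_mem {u : V} (hu : φ u = 1) {x : ExteriorAlgebra F V}
    (hx : x ∈ extPow k (U ⊓ LinearMap.ker φ)) : contract φ (ExteriorAlgebra.ι F u * x) = x := by
  rw [contract_ι_mul, hu, one_smul, LinearMap.mem_ker.1 (extPow_le_ker_contract inf_le_right k hx),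
    mul_zero, sub_zero]

theorem exists_mem_apply_eq_one (hU : ¬U ≤ LinearMap.ker φ) : ∃ u ∈ U, φ u = 1 := by
  obtain ⟨u, hu, h⟩ := SetLike.not_le_iff_exists.1 hU
  rw [LinearMap.mem_ker] at h
  exact ⟨(φ u)⁻¹ • u, U.smul_mem _ hu, by simp [h]⟩

theorem le_inf_ker_sup_span {u : V} (hu : u ∈ U) (h : φ u = 1) :
    U ≤ U ⊓ LinearMap.ker φ ⊔ F ∙ u := by
  refine fun v hv => Submodule.mem_sup.2 ⟨v - φ v • u, ⟨U.sub_mem hv (U.smul_mem _ hu), ?_⟩,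
    φ v • u, Submodule.smul_mem _ _ (Submodule.mem_span_singleton_self u), sub_add_cancel _ _⟩
  simp [h]

theorem exists_eq_add_ι_mul {u : V} (hu : u ∈ U) (h : φ u = 1) {x : ExteriorAlgebra F V}
    (hx : x ∈ extPow (k + 1) U) :
    ∃ y ∈ extPow (k + 1) (U ⊓ LinearMap.ker φ), ∃ z ∈ extPow k (U ⊓ LinearMap.ker φ),
      x = y + ExteriorAlgebra.ι F u * z ∧ contract φ x = z := by
  obtain ⟨y, hy, w, hw, rfl⟩ := Submodule.mem_sup.1 (extPow_succ_sup_span_le k _ u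
    (extPow_mono (k + 1) (le_inf_ker_sup_span hu h) hx))
  rw [Submodule.map_span, Set.image_singleton] at hw
  obtain ⟨z, hz, rfl⟩ := Submodule.mem_span_singleton_mul.1 hw
  refine ⟨y, hy, z, hz, rfl, ?_⟩
  rw [map_add, LinearMap.mem_ker.1 (extPow_le_ker_contract inf_le_right _ hy),
    contract_ι_mul_of_mem h hz, zero_add]

theorem extPow_succ_inf_ker_contract (k : ℕ) (U : Submodule F V) (φ : Dual F V) :
    extPow (k + 1) U ⊓ LinearMap.ker (contract φ) = extPow (k + 1) (U ⊓ LinearMap.ker φ) := by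
  refine le_antisymm ?_ (le_inf (extPow_mono _ inf_le_left) (extPow_le_ker_contract inf_le_right _))
  rintro x ⟨hx, hx0⟩
  by_cases hU : U ≤ LinearMap.ker φ
  · rwa [inf_eq_left.2 hU]
  obtain ⟨u, hu, h⟩ := exists_mem_apply_eq_one hU
  obtain ⟨y, hy, z, -, rfl, hz⟩ := exists_eq_add_ι_mul hu h hx
  rwa [← hz, LinearMap.mem_ker.1 hx0, mul_zero, add_zero]

theorem map_contract_extPow_succ (k : ℕ) (U : Submodule F V) (φ : Dual F V) :
    (extPow (k + 1) U).map (contract φ) =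
      if U ≤ LinearMap.ker φ then ⊥ else extPow k (U ⊓ LinearMap.ker φ) := by
  split_ifs with hU
  · exact LinearMap.le_ker_iff_map.1 (extPow_le_ker_contract hU _)
  obtain ⟨u, hu, h⟩ := exists_mem_apply_eq_one hU
  apply le_antisymm
  · rintro _ ⟨x, hx, rfl⟩
    obtain ⟨y, -, z, hz, -, hxz⟩ := exists_eq_add_ι_mul hu h hx
    rwa [hxz]
  · exact fun z hz =>
      ⟨_, ι_mul_mem_extPow hu (extPow_mono k inf_le_left hz), contract_ι_mul_of_mem h hz⟩

end ExteriorPowers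

section Exactness

variable {F V : Type*} [Field F] [AddCommGroup V] [Module F V] {A K : Submodule F V} {k : ℕ}

/-- For `A` and `K` independent, the system `⋀^k (K ⊓ U₀)` on the chains `U₀ ⊊ ⋯ ⊊ Uₚ` in the
half-open interval `[A, A ⊔ K)`. The local system of the building is the case `A = ⊥`, `K = ⊤`,
except that the vertex `⊥` is also allowed there. -/
def intervalCoeff (A K : Submodule F V) (k : ℕ) :
    Finset (Submodule F V) → Submodule F (ExteriorAlgebra F V) :=
  orderCoeff (Set.Ico A (A ⊔ K)) fun U => extPow k (K ⊓ U)

/-- The image of `intervalCoeff A K (k + 1)` under contraction by `φ`. -/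
def contractedCoeff (A K : Submodule F V) (φ : Dual F V) (k : ℕ) :
    Finset (Submodule F V) → Submodule F (ExteriorAlgebra F V) :=
  orderCoeff {U ∈ Set.Ico A (A ⊔ K) | ¬U ≤ LinearMap.ker φ}
    fun U => extPow k (K ⊓ LinearMap.ker φ ⊓ U)

theorem monotone_extPow_inf (k : ℕ) (K : Submodule F V) :
    Monotone fun U => extPow k (K ⊓ U) :=
  fun _ _ h => extPow_mono k (inf_le_inf_left K h)

theorem eq_sup_inf_of_mem_Ico {U : Submodule F V} (hU : U ∈ Set.Ico A (A ⊔ K)) :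
    A ⊔ K ⊓ U = U := by
  rw [← sup_inf_assoc_of_le K hU.1, inf_eq_right.2 hU.2.le]

theorem map_contract_intervalCoeff {φ : Dual F V} (hA : A ≤ LinearMap.ker φ)
    (hK : ¬K ≤ LinearMap.ker φ) (k : ℕ) :
    (fun s => (intervalCoeff A K (k + 1) s).map (contract φ)) = contractedCoeff A K φ k := by
  have hset : {U ∈ Set.Ico A (A ⊔ K) | ¬U ≤ LinearMap.ker φ} =
      {U ∈ Set.Ico A (A ⊔ K) | ¬K ⊓ U ≤ LinearMap.ker φ} := by
    ext U
    refine and_congr_right fun hU => not_congr ⟨inf_le_right.trans, fun h => ?_⟩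
    rw [← eq_sup_inf_of_mem_Ico hU]
    exact sup_le hA h
  rw [intervalCoeff, contractedCoeff, map_orderCoeff, hset]
  simp only [map_contract_extPow_succ]
  rw [orderCoeff_ite_bot _ _ (fun U W h => (inf_le_inf_left K h).trans) (by simpa using hK)]
  simp only [inf_right_comm]

theorem orderCoeff_lt_eq_contractedCoeff {U : Submodule F V} (φ : Dual F V)
    (hU : U ∈ Set.Ico A (A ⊔ K)) (k : ℕ) :
    orderCoeff {W ∈ {W ∈ Set.Ico A (A ⊔ K) | ¬W ≤ LinearMap.ker φ} | W < U}
      (fun W => extPow k (K ⊓ LinearMap.ker φ ⊓ (U ⊓ W))) = contractedCoeff A (K ⊓ U) φ k := by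
  have hset : {W ∈ {W ∈ Set.Ico A (A ⊔ K) | ¬W ≤ LinearMap.ker φ} | W < U} =
      {W ∈ Set.Ico A (A ⊔ K ⊓ U) | ¬W ≤ LinearMap.ker φ} := by
    ext W
    rw [eq_sup_inf_of_mem_Ico hU]
    exact ⟨fun h => ⟨⟨h.1.1.1, h.2⟩, h.1.2⟩, fun h => ⟨⟨⟨h.1.1, h.1.2.trans hU.2⟩, h.2⟩, h.1.2⟩⟩
  rw [contractedCoeff, hset]
  simp only [← inf_assoc, inf_right_comm]

theorem orderCoeff_span_le_eq_intervalCoeff {φ : Dual F V} {e : V} (he : e ∈ K) (hφ : φ e = 1)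
    (k : ℕ) :
    orderCoeff {U ∈ {U ∈ Set.Ico A (A ⊔ K) | ¬U ≤ LinearMap.ker φ} \
        {U | A ⊔ K ≤ U ⊔ F ∙ e} | F ∙ e ≤ U} (fun U => extPow k (K ⊓ LinearMap.ker φ ⊓ U)) =
      intervalCoeff (A ⊔ F ∙ e) (K ⊓ LinearMap.ker φ) k := by
  have hsup : A ⊔ F ∙ e ⊔ K ⊓ LinearMap.ker φ = A ⊔ K := by
    rw [sup_assoc, sup_comm (F ∙ e)]
    exact le_antisymm
      (sup_le_sup_left (sup_le inf_le_left ((Submodule.span_singleton_le_iff_mem e K).2 he)) A)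
      (sup_le_sup_left (le_inf_ker_sup_span he hφ) A)
  have hker {U : Submodule F V} (h : F ∙ e ≤ U) : ¬U ≤ LinearMap.ker φ := fun hU => by
    simpa [hφ] using hU ((Submodule.span_singleton_le_iff_mem e U).1 h)
  rw [intervalCoeff, hsup]
  congr 1
  ext U
  constructor
  · exact fun h => ⟨sup_le h.1.1.1.1 h.2, h.1.1.1.2⟩
  · intro h
    have heU : F ∙ e ≤ U := le_sup_right.trans h.1
    refine ⟨⟨⟨⟨le_sup_left.trans h.1, h.2⟩, hker heU⟩, fun hle => ?_⟩, heU⟩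
    exact h.2.not_ge (sup_eq_left.2 heU ▸ hle)

theorem disjoint_sup_span_inf_ker {φ : Dual F V} {e : V} (hAK : Disjoint A K)
    (hA : A ≤ LinearMap.ker φ) (hφ : φ e = 1) :
    Disjoint (A ⊔ F ∙ e) (K ⊓ LinearMap.ker φ) := by
  refine Submodule.disjoint_def.2 fun x hx hxK => ?_
  obtain ⟨a, ha, b, hb, rfl⟩ := Submodule.mem_sup.1 hx
  obtain ⟨t, rfl⟩ := Submodule.mem_span_singleton.1 hb
  have ht : t = 0 := by simpa [hφ, LinearMap.mem_ker.1 (hA ha)] using hxK.2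
  subst ht
  rw [zero_smul, add_zero] at hxK ⊢
  exact Submodule.disjoint_def.1 hAK a ha hxK.1

theorem not_lt_of_le_sup_span {U W X : Submodule F V} {e : V} (hU : X ≤ U ⊔ F ∙ e) (hW : W < X) :
    ¬U < W := by
  intro hUW
  by_cases he : e ∈ W
  · exact hW.not_ge (hU.trans (sup_le hUW.le ((Submodule.span_singleton_le_iff_mem e W).2 he)))
  · have h : W = U ⊔ (F ∙ e) ⊓ W := by
      rw [← sup_inf_assoc_of_le _ hUW.le, inf_eq_right.2 (hW.le.trans hU)]
    rw [(Submodule.disjoint_span_singleton_of_notMem he).symm.eq_bot, sup_bot_eq] at h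
    exact hUW.ne' h

theorem finrank_le_add_one [FiniteDimensional F V] {W : Submodule F V} {e : V}
    (h : K ≤ W ⊔ F ∙ e) : finrank F K ≤ finrank F W + 1 :=
  (Submodule.finrank_mono h).trans ((Submodule.finrank_add_le_finrank_add_finrank _ _).trans
    (Nat.add_le_add_left (by simpa using finrank_span_le_card (R := F) {e}) _))

theorem exists_dual_of_disjoint (hAK : Disjoint A K) (hK : K ≠ ⊥) :
    ∃ φ : Dual F V, A ≤ LinearMap.ker φ ∧ ∃ e ∈ K, φ e = 1 := by
  obtain ⟨v, hv, hv0⟩ := K.ne_bot_iff.1 hK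
  have hvA : v ∉ A := fun h => hv0 (Submodule.disjoint_def.1 hAK v h hv)
  obtain ⟨φ, hφ, hA⟩ := Submodule.exists_le_ker_of_notMem hvA
  exact ⟨φ, hA, exists_mem_apply_eq_one fun h => hφ (h hv)⟩

variable [Fintype (Submodule F V)]

theorem exactBelow_intervalCoeff_inf_ker {φ : Dual F V} (hA : A ≤ LinearMap.ker φ)
    (hK : ¬K ≤ LinearMap.ker φ) (k d : ℕ) :
    ExactBelow (fun s => intervalCoeff A K (k + 1) s ⊓ LinearMap.ker (contract φ)) d := by
  have hlt : (A ⊔ K) ⊓ LinearMap.ker φ < A ⊔ K := inf_lt_left.2 fun h => hK (le_sup_right.trans h)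
  rw [intervalCoeff, orderCoeff_inf]
  simp only [extPow_succ_inf_ker_contract]
  refine exactBelow_of_inf_mem (S := Set.Ico A (A ⊔ K)) (c := (A ⊔ K) ⊓ LinearMap.ker φ)
    (fun U W h => extPow_mono _ (inf_le_inf_right _ (inf_le_inf_left K h)))
    ⟨le_inf le_sup_left hA, hlt⟩
    (fun U hU => ⟨le_inf hU.1 (le_inf le_sup_left hA), inf_le_right.trans_lt hlt⟩)
    (fun U => extPow_mono _ ?_) d
  exact le_inf (le_inf (inf_le_left.trans inf_le_left) (le_inf (inf_le_left.trans inf_le_right)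
    (le_inf (inf_le_left.trans (inf_le_left.trans le_sup_right)) inf_le_right))) inf_le_right

theorem exactBelow_contractedCoeff_of_intervalCoeff {φ : Dual F V} {d : ℕ}
    (hA : A ≤ LinearMap.ker φ) (hK : ¬K ≤ LinearMap.ker φ)
    (h : ExactBelow (intervalCoeff A K (k + 1)) d) : ExactBelow (contractedCoeff A K φ k) d := by
  rw [← map_contract_intervalCoeff hA hK]
  exact h.map _ (antitone_orderCoeff (monotone_extPow_inf _ _))
    (exactBelow_intervalCoeff_inf_ker hA hK k d)

theorem exactBelow_contractedCoeff [FiniteDimensional F V] {φ : Dual F V} {e : V}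
    (hAK : Disjoint A K) (hA : A ≤ LinearMap.ker φ) (he : e ∈ K) (hφ : φ e = 1)
    (ih : ∀ K' < K, ∀ A', Disjoint A' K' → ∀ k,
      ExactBelow (intervalCoeff A' K' k) (finrank F K' - k)) :
    ExactBelow (contractedCoeff A K φ k) (finrank F K - (k + 1)) := by
  rcases hd : finrank F K - (k + 1) with _ | d
  · exact fun m hm => absurd hm m.not_lt_zero
  have heK : F ∙ e ≤ K := (Submodule.span_singleton_le_iff_mem e K).2 he
  have hL := monotone_extPow_inf k (K ⊓ LinearMap.ker φ)
  have hlt : K ⊓ LinearMap.ker φ < K := inf_lt_left.2 fun h => by simpa [hφ] using h he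
  set S := {U ∈ Set.Ico A (A ⊔ K) | ¬U ≤ LinearMap.ker φ}
  refine .of_maximal (T := {U ∈ S | A ⊔ K ≤ U ⊔ F ∙ e}) hL (Set.sep_subset _ _)
    (fun U hU W hW => not_lt_of_le_sup_span hU.2 hW.1.2) ?_ fun U hU => ?_
  · rw [show S \ {U ∈ S | A ⊔ K ≤ U ⊔ F ∙ e} = S \ {U | A ⊔ K ≤ U ⊔ F ∙ e} from
      Set.sdiff_self_inter]
    refine .of_sup_mem (c := F ∙ e) hL (fun U hU => ⟨⟨⟨?_, ?_⟩, ?_⟩, ?_⟩) ?_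
    · exact hU.1.1.1.trans le_sup_left
    · exact (sup_le hU.1.1.2.le (heK.trans le_sup_right)).lt_of_ne fun h => hU.2 h.ge
    · exact fun h => hU.1.2 (le_sup_left.trans h)
    · simpa [sup_assoc] using hU.2
    · rw [orderCoeff_span_le_eq_intervalCoeff he hφ]
      refine (ih _ hlt _ (disjoint_sup_span_inf_ker hAK hA hφ) k).mono ?_
      have := finrank_le_add_one (le_inf_ker_sup_span he hφ)
      lia
  · rw [orderCoeff_lt_eq_contractedCoeff φ hU.1.1]
    have hKU : K ⊓ U < K := inf_lt_left.2 fun h => hU.1.1.2.not_ge (sup_le hU.1.1.1 h)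
    have hker : ¬K ⊓ U ≤ LinearMap.ker φ := fun h =>
      hU.1.2 ((eq_sup_inf_of_mem_Ico hU.1.1).ge.trans (sup_le hA h))
    refine (exactBelow_contractedCoeff_of_intervalCoeff hA hker
      (ih _ hKU A (hAK.mono_right inf_le_left) (k + 1))).mono ?_
    have hK : K ≤ K ⊓ U ⊔ F ∙ e := by
      have := le_inf le_rfl (le_sup_right.trans hU.2)
      rwa [sup_comm, inf_comm, sup_inf_assoc_of_le _ heK, inf_comm, sup_comm] at this
    have := finrank_le_add_one hK
    lia

theorem exactBelow_intervalCoeff [FiniteDimensional F V] (hAK : Disjoint A K) (k : ℕ) :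
    ExactBelow (intervalCoeff A K k) (finrank F K - k) := by
  induction K using WellFoundedLT.induction generalizing A k with | ind K ih =>
  rcases eq_or_ne K ⊥ with rfl | hK
  · rw [finrank_bot, Nat.zero_sub]
    exact fun m hm => absurd hm m.not_lt_zero
  obtain ⟨φ, hA, e, he, hφ⟩ := exists_dual_of_disjoint hAK hK
  have hKφ : ¬K ≤ LinearMap.ker φ := fun h => by simpa [hφ] using h he
  rcases k with _ | k
  · have hAmem : A ∈ Set.Ico A (A ⊔ K) := ⟨le_rfl, left_lt_sup.2 fun h => hKφ (h.trans hA)⟩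
    refine exactBelow_of_le_insert (x := A) (fun s => ?_) _
    exact orderCoeff_le_insert hAmem (fun _ hS W hW => Or.inr (hS hW).1) (by simp [extPow_zero])
  · refine exactBelow_of_ker_of_map (contract φ) (antitone_orderCoeff (monotone_extPow_inf _ _))
      (exactBelow_intervalCoeff_inf_ker hA hKφ _ _) ?_
    rw [map_contract_intervalCoeff hA hKφ]
    exact exactBelow_contractedCoeff hAK hA he hφ fun K' hK' A' h k => ih K' hK' h k

end Exactness

/-! ### The local system of the building -/

section Comparison

variable {F V : Type*} [Field F] [AddCommGroup V] [Module F V] {k m : ℕ}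

/-- The canonical map from `⋀^k U` to the exterior algebra of the ambient space `V`. -/
def toExt (k : ℕ) (U : Submodule F V) : ⋀[F]^k U →ₗ[F] ExteriorAlgebra F V :=
  (ExteriorAlgebra.map U.subtype).toLinearMap ∘ₗ Submodule.subtype _

theorem toExt_injective (k : ℕ) (U : Submodule F V) : Function.Injective (toExt k U) :=
  (ExteriorAlgebra.map_injective_field (by simp)).comp Subtype.val_injective

theorem range_toExt (k : ℕ) (U : Submodule F V) : LinearMap.range (toExt k U) = extPow k U := by
  rw [toExt, LinearMap.range_comp, Submodule.range_subtype, extPow]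
  erw [Submodule.map_pow, ExteriorAlgebra.ι_range_map_map, Submodule.range_subtype]

theorem toExt_map_inclusion (k : ℕ) {U U' : Submodule F V} (h : U ≤ U') (x : ⋀[F]^k U) :
    toExt k U' (exteriorPower.map k (Submodule.inclusion h) x) = toExt k U x := by
  suffices H : toExt k U' ∘ₗ exteriorPower.map k (Submodule.inclusion h) = toExt k U from
    LinearMap.congr_fun H x
  ext v
  simp only [LinearMap.compAlternatingMap_apply, LinearMap.comp_apply, toExt,
    exteriorPower.map_apply_ιMulti, Submodule.subtype_apply, exteriorPower.ιMulti_apply_coe,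
    AlgHom.toLinearMap_apply, ExteriorAlgebra.map_apply_ιMulti]
  rfl

instance finite_extPow [FiniteDimensional F V] (k : ℕ) (U : Submodule F V) :
    Module.Finite F (extPow k U) :=
  range_toExt k U ▸ inferInstance

theorem finrank_extPow [FiniteDimensional F V] (k : ℕ) (U : Submodule F V) :
    finrank F (extPow k U) = (finrank F U).choose k := by
  rw [← range_toExt, LinearMap.finrank_range_of_inj (toExt_injective k U), exteriorPower.finrank_eq]

/-- The set of vertices of a simplex. -/
def Simplex.verts (σ : Simplex F V m) : Finset (Submodule F V) :=
  Finset.univ.image fun i => (σ i).1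

theorem Simplex.val_injective (σ : Simplex F V m) : Function.Injective fun i => (σ i).1 :=
  Subtype.val_injective.comp σ.injective

theorem Simplex.card_verts (σ : Simplex F V m) : σ.verts.card = m := by
  rw [verts, Finset.card_image_of_injective _ σ.val_injective, Finset.card_fin]

theorem Simplex.isChain_verts (σ : Simplex F V m) :
    IsChain (· ≤ ·) (σ.verts : Set (Submodule F V)) := by
  intro x hx y hy _
  obtain ⟨i, -, rfl⟩ := Finset.mem_image.1 hx
  obtain ⟨j, -, rfl⟩ := Finset.mem_image.1 hy
  exact (le_total i j).imp (fun h => σ.monotone h) fun h => σ.monotone h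

theorem Simplex.verts_subset_Iio_top (σ : Simplex F V m) :
    (σ.verts : Set (Submodule F V)) ⊆ Set.Iio ⊤ := by
  simp [verts, Set.range_subset_iff, lt_top_iff_ne_top, (σ _).2.2]

theorem Simplex.verts_injective (m : ℕ) :
    Function.Injective (verts : Simplex F V m → Finset (Submodule F V)) := by
  intro σ τ h
  refine DFunLike.coe_injective ((StrictMono.range_inj σ.strictMono τ.strictMono).1 ?_)
  ext x
  simpa [verts, Subtype.ext_iff] using congrArg (x.1 ∈ ·) h

theorem Simplex.exists_verts_eq {s : Finset (Submodule F V)}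
    (h : IsChain (· ≤ ·) (s : Set (Submodule F V))) (h' : ∀ U ∈ s, U ≠ ⊥ ∧ U ≠ ⊤) :
    ∃ σ : Simplex F V s.card, σ.verts = s := by
  let _ : LinearOrder (s : Set (Submodule F V)) := h.linearOrder
  let f := Fintype.orderIsoFinOfCardEq (s : Set (Submodule F V)) (k := s.card) (by simp)
  refine ⟨OrderEmbedding.ofMapLEIff (fun i => ⟨(f i).1, h' _ (f i).2⟩) fun i j => f.le_iff_le, ?_⟩
  ext U
  simp only [verts, Finset.mem_image, Finset.mem_univ, true_and]
  exact ⟨fun ⟨i, hi⟩ => hi ▸ (f i).2,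
    fun hU => ⟨f.symm ⟨U, hU⟩, congrArg Subtype.val (f.apply_symm_apply _)⟩⟩

theorem Simplex.inf_verts (σ : Simplex F V m) : σ.verts.inf id = coeff σ := by
  cases m with
  | zero => simp [verts, coeff]
  | succ m =>
    refine le_antisymm (Finset.inf_le (f := id) (Finset.mem_image_of_mem _ (Finset.mem_univ 0)))
      (Finset.le_inf fun x hx => ?_)
    obtain ⟨i, -, rfl⟩ := Finset.mem_image.1 hx
    exact σ.monotone (Fin.zero_le i)

theorem Simplex.verts_face (σ : Simplex F V (m + 1)) (i : Fin (m + 1)) :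
    (σ.face i).verts = σ.verts.erase (σ i).1 := by
  ext U
  simp only [verts, face, Finset.mem_image, Finset.mem_univ, true_and, Finset.mem_erase]
  constructor
  · rintro ⟨j, rfl⟩
    exact ⟨fun h => Fin.succAbove_ne i j (σ.val_injective h), _, rfl⟩
  · rintro ⟨h, j, rfl⟩
    obtain ⟨l, rfl⟩ := Fin.exists_succAbove_eq (x := j) (y := i) (fun h' => h (by rw [h']))
    exact ⟨l, rfl⟩

theorem Simplex.vertexSign_verts (σ : Simplex F V m) (i : Fin m) :
    vertexSign (σ i).1 σ.verts = (-1) ^ (i : ℕ) := by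
  have hmono : StrictMono fun j => toLinearExtension (σ j).1 :=
    Monotone.strictMono_of_injective (fun i j h => toLinearExtension.monotone (σ.monotone h))
      σ.val_injective
  rw [vertexSign, verts, Finset.prod_image σ.val_injective.injOn]
  simp_rw [hmono.lt_iff_lt]
  simp [Finset.prod_ite, Finset.filter_gt_eq_Iio]

variable (F V) in
/-- The local system `⋀^k 𝔤`, as a coefficient system with values in the exterior algebra of `V`.
The vertex `⊥` is also allowed, but for `k ≠ 0` it contributes nothing since `⋀^k ⊥ = 0`. -/
def buildingCoeff (k : ℕ) : Finset (Submodule F V) → Submodule F (ExteriorAlgebra F V) :=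
  orderCoeff (Set.Iio ⊤) (extPow k)

theorem intervalCoeff_bot_top (k : ℕ) : intervalCoeff ⊥ ⊤ k = buildingCoeff F V k := by
  rw [intervalCoeff, buildingCoeff, bot_sup_eq, Set.Ico_bot]
  simp only [top_inf_eq]

instance finite_buildingCoeff [FiniteDimensional F V] (k : ℕ) (s : Finset (Submodule F V)) :
    Module.Finite F (buildingCoeff F V k s) := by
  by_cases hs : IsChain (· ≤ ·) (s : Set (Submodule F V)) ∧ ↑s ⊆ Set.Iio (⊤ : Submodule F V)
  · rw [buildingCoeff, orderCoeff, if_pos hs]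
    infer_instance
  · rw [buildingCoeff, orderCoeff, if_neg hs]
    infer_instance

theorem buildingCoeff_verts (k : ℕ) (σ : Simplex F V m) :
    buildingCoeff F V k σ.verts = LinearMap.range (toExt k (coeff σ)) := by
  rw [buildingCoeff, orderCoeff_of_isChain σ.isChain_verts σ.verts_subset_Iio_top, σ.inf_verts,
    range_toExt]

theorem buildingCoeff_eq_bot_of_notMem_range (hk : k ≠ 0) {s : Finset (Submodule F V)}
    (hs : ∀ σ : Simplex F V s.card, σ.verts ≠ s) : buildingCoeff F V k s = ⊥ := by
  refine le_bot_iff.1 (orderCoeff_le fun hchain hS => ?_)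
  obtain ⟨k, rfl⟩ := Nat.exists_eq_succ_of_ne_zero hk
  by_cases hbot : ⊥ ∈ s
  · rw [le_bot_iff.1 (Finset.inf_le (f := id) hbot), extPow_succ_bot]
  · obtain ⟨σ, hσ⟩ := Simplex.exists_verts_eq hchain fun U hU =>
      ⟨fun h => hbot (h ▸ hU), (hS hU).ne⟩
    exact absurd hσ (hs σ)

theorem finrank_inf_add_card_le [FiniteDimensional F V] {s : Finset (Submodule F V)}
    (hs : IsChain (· ≤ ·) (s : Set (Submodule F V))) (hS : ↑s ⊆ Set.Iio (⊤ : Submodule F V)) :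
    finrank F (s.inf id : Submodule F V) + s.card ≤ finrank F V := by
  have hcard : s.card ≤ (Finset.Ico (finrank F (s.inf id : Submodule F V)) (finrank F V)).card := by
    refine Finset.card_le_card_of_injOn (fun U => finrank F U) (fun U hU => ?_)
      fun U hU W hW h => ?_
    · exact Finset.mem_coe.2 (Finset.mem_Ico.2 ⟨Submodule.finrank_mono (Finset.inf_le (f := id) hU),
        Submodule.finrank_lt (hS hU).ne⟩)
    · rcases hs.total hU hW with hle | hle
      · exact Submodule.eq_of_le_of_finrank_eq hle h
      · exact (Submodule.eq_of_le_of_finrank_eq hle h.symm).symm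
  have := Submodule.finrank_le (s.inf id : Submodule F V)
  rw [Nat.card_Ico] at hcard
  lia

theorem buildingCoeff_eq_bot [FiniteDimensional F V] {s : Finset (Submodule F V)}
    (h : finrank F V < k + s.card) : buildingCoeff F V k s = ⊥ := by
  refine le_bot_iff.1 (orderCoeff_le fun hs hS => (Submodule.finrank_eq_zero.1 ?_).le)
  have := finrank_inf_add_card_le hs hS
  rw [finrank_extPow, Nat.choose_eq_zero_of_lt (by lia)]

variable (F V) in
/-- The twisted chains as functions on the finite sets of subspaces, with values in the exterior
algebra of `V`. -/
def Chains.toFun (k m : ℕ) :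
    Chains F V k m →ₗ[F] (Finset (Submodule F V) → ExteriorAlgebra F V) :=
  DirectSum.toModule F _ _ fun σ => LinearMap.single F _ σ.verts ∘ₗ toExt k (coeff σ)

theorem Chains.toFun_single (k : ℕ) (σ : Simplex F V m) (x : ⋀[F]^k (coeff σ)) :
    toFun F V k m (single k σ x) = Pi.single σ.verts (toExt k (coeff σ) x) := by
  unfold toFun single
  erw [DirectSum.toModule_lof]
  rfl

theorem Chains.induction {p : Chains F V k m → Prop} (zero : p 0)
    (single : ∀ σ x, p (Chains.single k σ x)) (add : ∀ x y, p x → p y → p (x + y))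
    (c : Chains F V k m) : p c :=
  DirectSum.induction_on c zero single add

theorem Chains.toFun_mem_chains (c : Chains F V k m) :
    toFun F V k m c ∈ chains (buildingCoeff F V k) m := by
  induction c using Chains.induction with
  | zero => rw [map_zero]; exact zero_mem _
  | single σ x =>
    have h := single_mem_chains (buildingCoeff_verts k σ ▸ LinearMap.mem_range_self (toExt k _) x)
    rwa [σ.card_verts, ← toFun_single] at h
  | add x y hx hy => rw [map_add]; exact add_mem hx hy

section Finite

variable [Finite (Submodule F V)]

instance fintype_simplex : Fintype (Simplex F V m) :=
  @Fintype.ofFinite _ (DFunLike.finite _)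

/-- The coefficients of a twisted chain. -/
def Chains.equivPi (k m : ℕ) : Chains F V k m ≃ₗ[F] (∀ σ : Simplex F V m, ⋀[F]^k (coeff σ)) :=
  DirectSum.linearEquivFunOnFintype F _ _

theorem Chains.equivPi_single (k : ℕ) (σ : Simplex F V m) (x : ⋀[F]^k (coeff σ)) :
    equivPi k m (single k σ x) = Pi.single σ x :=
  DirectSum.linearEquivFunOnFintype_lof F (M := fun τ => ⋀[F]^k (coeff τ)) σ x

theorem Chains.toFun_verts (c : Chains F V k m) (σ : Simplex F V m) :
    toFun F V k m c σ.verts = toExt k (coeff σ) (equivPi k m c σ) := by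
  induction c using Chains.induction with
  | zero => simp only [map_zero, Pi.zero_apply]
  | single τ x =>
    rw [toFun_single, equivPi_single]
    rcases eq_or_ne σ τ with rfl | h
    · rw [Pi.single_eq_same, Pi.single_eq_same]
    · rw [Pi.single_eq_of_ne h, Pi.single_eq_of_ne ((Simplex.verts_injective m).ne h), map_zero]
  | add x y hx hy => simp only [map_add, Pi.add_apply, hx, hy]

theorem Chains.toFun_injective (k m : ℕ) : Function.Injective (toFun F V k m) := by
  refine fun c c' h => (equivPi k m).injective (funext fun σ => toExt_injective k _ ?_)
  rw [← toFun_verts, h, toFun_verts]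

theorem Chains.range_toFun (hk : k ≠ 0) (m : ℕ) :
    LinearMap.range (toFun F V k m) = chains (buildingCoeff F V k) m := by
  refine le_antisymm (LinearMap.range_le_iff_comap.2 (eq_top_iff.2 fun c _ => toFun_mem_chains c))
    fun w hw => ?_
  have hpre (σ : Simplex F V m) : ∃ x, toExt k (coeff σ) x = w σ.verts := by
    rw [← LinearMap.mem_range, ← buildingCoeff_verts]
    exact hw.1 _
  choose x hx using hpre
  refine ⟨(equivPi k m).symm x, funext fun s => ?_⟩
  by_cases hs : ∃ σ : Simplex F V m, σ.verts = s
  · obtain ⟨σ, rfl⟩ := hs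
    rw [toFun_verts, LinearEquiv.apply_symm_apply, hx]
  · have hzero {c} (hc : c ∈ chains (buildingCoeff F V k) m) : c s = 0 := by
      by_cases hm : s.card = m
      · subst hm
        simpa [buildingCoeff_eq_bot_of_notMem_range hk (not_exists.1 hs)] using hc.1 s
      · exact hc.2 s hm
    rw [hzero hw, hzero (toFun_mem_chains _)]

theorem subsingleton_chains [FiniteDimensional F V] (h : finrank F V < k + m) :
    Subsingleton (Chains F V k m) := by
  have hzero (c : Chains F V k m) : Chains.toFun F V k m c = 0 := by
    have hc := Chains.toFun_mem_chains c
    refine funext fun s => ?_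
    by_cases hs : s.card = m
    · simpa [buildingCoeff_eq_bot (k := k) (hs ▸ h)] using hc.1 s
    · exact hc.2 s hs
  exact ⟨fun c c' => Chains.toFun_injective k m ((hzero c).trans (hzero c').symm)⟩

end Finite

variable [Fintype (Submodule F V)]

theorem Chains.differential_toFun (c : Chains F V k (m + 1)) :
    differential F (toFun F V k (m + 1) c) = toFun F V k m (boundary F V k m c) := by
  induction c using Chains.induction with
  | zero => simp only [map_zero]
  | single σ x =>
    rw [toFun_single, differential_single, boundary_single, map_sum, Simplex.verts,
      Finset.sum_image σ.val_injective.injOn, ← Simplex.verts]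
    refine Finset.sum_congr rfl fun i _ => ?_
    rw [map_smul, toFun_single, toExt_map_inclusion, σ.verts_face, σ.vertexSign_verts,
      ← Int.cast_smul_eq_zsmul F]
    norm_num
  | add x y hx hy => simp only [map_add, hx, hy]

theorem map_toFun_ker_boundary (hk : k ≠ 0) (m : ℕ) :
    (LinearMap.ker (boundary F V k m)).map (Chains.toFun F V k (m + 1)) =
      cycles (buildingCoeff F V k) (m + 1) := by
  have hcomp : differential F ∘ₗ Chains.toFun F V k (m + 1) =
      Chains.toFun F V k m ∘ₗ boundary F V k m := LinearMap.ext Chains.differential_toFun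
  rw [cycles, ← Chains.range_toFun hk, ← Submodule.map_comap_eq, ← LinearMap.ker_comp, hcomp,
    LinearMap.ker_comp_of_ker_eq_bot _ (LinearMap.ker_eq_bot.2 (Chains.toFun_injective k m))]

theorem finrank_D [FiniteDimensional F V] (hk : k ≠ 0) (hkV : k < finrank F V) :
    finrank F (D F V k) = finrank F (cycles (buildingCoeff F V k) (finrank F V - k)) := by
  have : Subsingleton (Chains F V k (finrank F V - k - 1 + 1 + 1)) :=
    subsingleton_chains (by lia)
  have hrange : LinearMap.range (boundary F V k (finrank F V - k - 1 + 1)) = ⊥ :=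
    LinearMap.range_eq_bot.2 (Subsingleton.elim _ _)
  have hbot : (LinearMap.range (boundary F V k (finrank F V - k - 1 + 1))).submoduleOf
      (LinearMap.ker (boundary F V k (finrank F V - k - 1))) = ⊥ := by
    rw [hrange, Submodule.submoduleOf, Submodule.comap_bot, Submodule.ker_subtype]
  unfold D ReducedHomology
  rw [(Submodule.quotEquivOfEqBot _ hbot).finrank_eq,
    (Submodule.equivMapOfInjective _ (Chains.toFun_injective k _) _).finrank_eq,
    map_toFun_ker_boundary hk, Nat.sub_add_cancel (by lia)]

end Comparison

/-! ### Counting -/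

section ChainSums

/-- The chains of elements strictly below `X`. -/
def chainsBelow {P : Type*} [Preorder P] [Fintype P] (X : P) : Finset (Finset P) :=
  Finset.univ.filter fun s => IsChain (· ≤ ·) (s : Set P) ∧ ↑s ⊆ Set.Iio X

theorem mem_chainsBelow {P : Type*} [Preorder P] [Fintype P] {X : P} {s : Finset P} :
    s ∈ chainsBelow X ↔ IsChain (· ≤ ·) (s : Set P) ∧ ↑s ⊆ Set.Iio X := by
  simp [chainsBelow]

theorem sup_id_mem_of_isChain {P : Type*} [Lattice P] [OrderBot P] {s : Finset P}
    (hs : s.Nonempty) (h : IsChain (· ≤ ·) (s : Set P)) : s.sup id ∈ s := by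
  rw [← Finset.sup'_eq_sup hs]
  refine Finset.sup'_mem (s : Set P) (fun x hx y hy => ?_) s hs id fun x hx => hx
  rcases h.total hx hy with hxy | hxy
  · rwa [sup_eq_right.2 hxy]
  · rwa [sup_eq_left.2 hxy]

variable {P R : Type*} [Lattice P] [BoundedOrder P] [Fintype P] [Ring R]

/-- The alternating sum of the values of `f` at the least elements of the chains below `X`, where
the empty chain contributes `f X`. -/
def chainSum (f : P → R) (X : P) : R :=
  ∑ s ∈ chainsBelow X, (-1) ^ s.card * f (X ⊓ s.inf id)

theorem filter_sup_chainsBelow {U X : P} (hU : U < X) :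
    ((chainsBelow X).erase ∅).filter (fun s => s.sup id = U) =
      (chainsBelow U).image (insert U) := by
  ext s
  simp only [Finset.mem_filter, Finset.mem_erase, Finset.mem_image, mem_chainsBelow]
  constructor
  · rintro ⟨⟨hne, hs, -⟩, rfl⟩
    have hmem := sup_id_mem_of_isChain (Finset.nonempty_iff_ne_empty.2 hne) hs
    refine ⟨s.erase (s.sup id), ⟨hs.mono (by simp), fun W hW => ?_⟩, Finset.insert_erase hmem⟩
    obtain ⟨hWne, hW⟩ := Finset.mem_erase.1 hW
    exact (Finset.le_sup (f := id) hW).lt_of_ne hWne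
  · rintro ⟨t, ⟨ht, htU⟩, rfl⟩
    refine ⟨⟨Finset.insert_ne_empty _ _, ?_, ?_⟩, ?_⟩
    · rw [Finset.coe_insert]
      exact ht.insert fun W hW _ => Or.inr (htU hW).le
    · rw [Finset.coe_insert]
      exact Set.insert_subset hU fun W hW => (htU hW).trans hU
    · rw [Finset.sup_insert]
      exact sup_eq_left.2 (Finset.sup_le fun W hW => (htU hW).le)

/-- Grouping the nonempty chains below `X` by their greatest element. -/
theorem chainSum_eq_sub (f : P → R) (X : P) :
    chainSum f X = f X - ∑ U with U < X, chainSum f U := by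
  have hempty : ∅ ∈ chainsBelow X := by simp [mem_chainsBelow]
  have hmaps : ∀ s ∈ (chainsBelow X).erase ∅, s.sup id ∈ Finset.univ.filter (· < X) := by
    intro s hs
    obtain ⟨hne, hs⟩ := Finset.mem_erase.1 hs
    obtain ⟨hs, hsX⟩ := mem_chainsBelow.1 hs
    simpa using hsX (sup_id_mem_of_isChain (Finset.nonempty_iff_ne_empty.2 hne) hs)
  rw [chainSum, ← Finset.add_sum_erase _ _ hempty, sub_eq_add_neg]
  congr 1
  · simp
  rw [← Finset.sum_fiberwise_of_maps_to hmaps, ← Finset.sum_neg_distrib]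
  refine Finset.sum_congr rfl fun U hU => ?_
  have hUX : U < X := (Finset.mem_filter.1 hU).2
  have hnot : ∀ s ∈ chainsBelow U, U ∉ s := fun s hs h =>
    lt_irrefl U ((mem_chainsBelow.1 hs).2 h)
  rw [filter_sup_chainsBelow hUX, Finset.sum_image, chainSum, ← Finset.sum_neg_distrib]
  · refine Finset.sum_congr rfl fun s hs => ?_
    rw [Finset.card_insert_of_notMem (hnot s hs), Finset.inf_insert, id, ← inf_assoc,
      inf_eq_right.2 hUX.le, pow_succ, mul_neg_one, neg_mul]
  · intro s hs t ht hst
    rw [← Finset.erase_insert (hnot s hs), hst, Finset.erase_insert (hnot t ht)]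

/-- Philip Hall's theorem: `chainSum f` is the Möbius inverse of `f`. -/
theorem chainSum_eq_of_sum_eq {f g : P → R} (h : ∀ X, ∑ U with U ≤ X, g U = f X) (X : P) :
    chainSum f X = g X := by
  induction X using WellFoundedLT.induction with
  | ind X ih =>
    have hins : Finset.univ.filter (· ≤ X) = insert X (Finset.univ.filter (· < X)) := by
      ext U
      simp [le_iff_eq_or_lt]
    rw [chainSum_eq_sub, ← h X, hins, Finset.sum_insert (by simp), sub_eq_iff_eq_add]
    congr 1
    exact Finset.sum_congr rfl fun U hU => (ih U (Finset.mem_filter.1 hU).2).symm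

end ChainSums

section SpanningTuples

variable {F V : Type*} [Field F] [AddCommGroup V] [Module F V]

theorem linearIndependent_row_iff_span_col_eq_top {d s : ℕ} (r : Matrix (Fin d) (Fin s) F) :
    LinearIndependent F r.row ↔ Submodule.span F (Set.range r.col) = ⊤ := by
  rw [linearIndependent_iff_card_eq_finrank_span, Set.finrank, ← Matrix.rank_eq_finrank_span_row,
    Matrix.rank_eq_finrank_span_cols]
  refine ⟨fun h => Submodule.eq_top_of_finrank_eq ?_, fun h => ?_⟩
  · rw [← h, finrank_fintype_fun_eq_card]
  · rw [h, finrank_top, finrank_fintype_fun_eq_card]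

theorem natCard_linearIndependent [Finite F] (d s : ℕ) :
    (Nat.card {r : Fin d → Fin s → F // LinearIndependent F r} : ℤ) =
      ∏ i ∈ Finset.range d, ((Nat.card F : ℤ) ^ s - (Nat.card F : ℤ) ^ i) := by
  let _ := Fintype.ofFinite F
  have hfr : finrank F (Fin s → F) = s := by simp
  rcases le_or_gt d s with h | h
  · rw [card_linearIndependent (hfr.symm ▸ h), hfr, Fintype.card_eq_nat_card, Finset.prod_range,
      Nat.cast_prod]
    refine Finset.prod_congr rfl fun i _ => ?_
    rw [Nat.cast_sub (Nat.pow_le_pow_right Nat.card_pos (i.2.le.trans h)), Nat.cast_pow,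
      Nat.cast_pow]
  · have : IsEmpty {r : Fin d → Fin s → F // LinearIndependent F r} :=
      ⟨fun r => h.not_ge (by simpa using r.2.fintype_card_le_finrank)⟩
    rw [Finset.prod_eq_zero (Finset.mem_range.2 h) (sub_self _), Nat.card_of_isEmpty, Nat.cast_zero]

theorem natCard_span_eq_top [Finite F] [FiniteDimensional F V] (s : ℕ) :
    (Nat.card {v : Fin s → V // Submodule.span F (Set.range v) = ⊤} : ℤ) =
      ∏ i ∈ Finset.range (finrank F V), ((Nat.card F : ℤ) ^ s - (Nat.card F : ℤ) ^ i) := by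
  rw [← natCard_linearIndependent]
  congr 1
  let b : V ≃ₗ[F] (Fin (finrank F V) → F) := (finBasis F V).equivFun
  let e : (Fin s → V) ≃ (Fin (finrank F V) → Fin s → F) :=
    (Equiv.piCongrRight fun _ => b.toEquiv).trans (Equiv.piComm _)
  refine Nat.card_congr (e.subtypeEquiv fun v => ?_)
  have hcol : (Matrix.of (e v)).col = b ∘ v := rfl
  refine Iff.trans ?_ (linearIndependent_row_iff_span_col_eq_top (Matrix.of (e v))).symm
  rw [hcol, Set.range_comp, ← LinearEquiv.coe_coe, ← Submodule.map_span,
    Submodule.map_eq_top_iff]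

theorem natCard_span_eq [Finite F] [FiniteDimensional F V] (U : Submodule F V) (s : ℕ) :
    (Nat.card {v : Fin s → V // Submodule.span F (Set.range v) = U} : ℤ) =
      ∏ i ∈ Finset.range (finrank F U), ((Nat.card F : ℤ) ^ s - (Nat.card F : ℤ) ^ i) := by
  rw [← natCard_span_eq_top (V := U)]
  congr 1
  have hspan (v : Fin s → U) : Submodule.span F (Set.range v) = ⊤ ↔
      Submodule.span F (Set.range fun i => (v i : V)) = U := by
    rw [← (Submodule.map_injective_of_injective U.subtype_injective).eq_iff, Submodule.map_span,
      ← Set.range_comp, Submodule.map_top, Submodule.range_subtype]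
    rfl
  refine (Nat.card_congr (Equiv.ofBijective
    (fun v => ⟨fun i => (v.1 i : V), (hspan v.1).1 v.2⟩) ⟨fun v w h => ?_, ?_⟩)).symm
  · ext i
    exact congrFun (congrArg Subtype.val h) i
  · rintro ⟨v, hv⟩
    have hmem (i : Fin s) : v i ∈ U := hv ▸ Submodule.subset_span ⟨i, rfl⟩
    exact ⟨⟨fun i => ⟨v i, hmem i⟩, (hspan _).2 hv⟩, rfl⟩

variable [Finite F] [FiniteDimensional F V] [Fintype (Submodule F V)]

/-- Both sides count the `s`-tuples of vectors of `X`, on the left according to their span. -/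
theorem sum_prod_pow_sub_pow (X : Submodule F V) (s : ℕ) :
    ∑ U with U ≤ X, ∏ i ∈ Finset.range (finrank F U),
      ((Nat.card F : ℤ) ^ s - (Nat.card F : ℤ) ^ i) = ((Nat.card F : ℤ) ^ s) ^ finrank F X := by
  have : Finite V := Module.finite_of_finite F
  let _ := Fintype.ofFinite V
  have htuples : (Finset.univ.filter fun v : Fin s → V => ∀ i, v i ∈ X).card =
      (Nat.card F ^ s) ^ finrank F X := by
    rw [← Fintype.card_subtype, Fintype.card_eq_nat_card,
      Nat.card_congr (Equiv.subtypePiEquivPi (p := fun _ v => v ∈ X)), Nat.card_fun, Nat.card_fin,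
      pow_right_comm, ← Module.natCard_eq_pow_finrank]
  have hmaps : Set.MapsTo (fun v : Fin s → V => Submodule.span F (Set.range v))
      (Finset.univ.filter fun v : Fin s → V => ∀ i, v i ∈ X) (Finset.univ.filter (· ≤ X)) := by
    intro v hv
    simpa [Submodule.span_le, Set.range_subset_iff] using hv
  have hsum := congrArg (Nat.cast (R := ℤ)) (Finset.card_eq_sum_card_fiberwise hmaps)
  rw [htuples, Nat.cast_pow, Nat.cast_pow, Nat.cast_sum] at hsum
  rw [hsum]
  refine Finset.sum_congr rfl fun U hU => ?_
  rw [← natCard_span_eq, ← Fintype.card_eq_nat_card, Fintype.card_subtype, Finset.filter_filter]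
  congr 2
  ext v
  simp only [Finset.mem_filter, Finset.mem_univ, true_and] at hU ⊢
  exact ⟨fun h => ⟨fun i => hU (h ▸ Submodule.subset_span ⟨i, rfl⟩), h⟩, And.right⟩

open Polynomial in
theorem sum_prod_X_sub_C_pow (X : Submodule F V) :
    ∑ U with U ≤ X, ∏ i ∈ Finset.range (finrank F U),
      ((Polynomial.X : ℤ[X]) - C ((Nat.card F : ℤ) ^ i)) = Polynomial.X ^ finrank F X := by
  have hinj : Function.Injective fun s : ℕ => (Nat.card F : ℤ) ^ s :=
    Int.pow_right_injective (mod_cast Finite.one_lt_card)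
  refine Polynomial.eq_of_infinite_eval_eq _ _ ((Set.infinite_range_of_injective hinj).mono ?_)
  rintro _ ⟨s, rfl⟩
  simpa [eval_finsetSum, eval_prod] using sum_prod_pow_sub_pow X s

end SpanningTuples

section Dimension

variable {F V : Type*} [Field F] [AddCommGroup V] [Module F V]

open Polynomial in
theorem coeff_prod_X_add_C_one_sub_pow (q : ℤ) {n k : ℕ} (hk : k ≤ n) :
    (∏ i ∈ Finset.range n, ((X : ℤ[X]) + C (1 - q ^ i))).coeff k =
      (-1) ^ (n - k) * ∑ α ∈ Finset.powersetCard (n - k) (Finset.Icc 1 (n - 1)),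
        ∏ j ∈ α, (q ^ j - 1) := by
  rw [Finset.prod_X_add_C_coeff _ _ (by simpa using hk), Finset.card_range, Finset.mul_sum]
  refine (Finset.sum_subset_zero_on_sdiff (Finset.powersetCard_mono fun i hi => ?_) ?_ ?_).symm
  · simp only [Finset.mem_Icc, Finset.mem_range] at hi ⊢
    omega
  · intro α hα
    simp only [Finset.mem_sdiff, Finset.mem_powersetCard, not_and'] at hα
    have hzero : 0 ∈ α := by
      by_contra h0
      refine hα.2 hα.1.2 fun i hi => ?_
      have hin := Finset.mem_range.1 (hα.1.1 hi)
      have hi0 : i ≠ 0 := fun h => h0 (h ▸ hi)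
      rw [Finset.mem_Icc]
      omega
    exact Finset.prod_eq_zero hzero (by simp)
  · intro α hα
    rw [← (Finset.mem_powersetCard.1 hα).2, ← Finset.prod_const, ← Finset.prod_mul_distrib]
    exact Finset.prod_congr rfl fun i _ => by ring

variable [FiniteDimensional F V] [Fintype (Submodule F V)]

/-- The coefficient of `T ^ k` in the characteristic polynomial of the lattice of subspaces,
evaluated at `T + 1`. -/
theorem chainSum_choose [Finite F] (X : Submodule F V) {k : ℕ} (hk : k ≤ finrank F X) :
    chainSum (fun U : Submodule F V => ((finrank F U).choose k : ℤ)) X =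
      (-1) ^ (finrank F X - k) *
        ∑ α ∈ Finset.powersetCard (finrank F X - k) (Finset.Icc 1 (finrank F X - 1)),
          ∏ j ∈ α, ((Nat.card F : ℤ) ^ j - 1) := by
  rw [← coeff_prod_X_add_C_one_sub_pow _ hk]
  refine chainSum_eq_of_sum_eq (g := fun U : Submodule F V => (∏ i ∈ Finset.range (finrank F U),
    (Polynomial.X + Polynomial.C (1 - (Nat.card F : ℤ) ^ i))).coeff k) (fun Y => ?_) X
  have h := congrArg (fun p => (p.comp (Polynomial.X + 1)).coeff k) (sum_prod_X_sub_C_pow Y)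
  simp only [Polynomial.sum_comp, Polynomial.prod_comp, Polynomial.sub_comp, Polynomial.X_comp,
    Polynomial.C_comp, Polynomial.pow_comp, Polynomial.finsetSum_coeff,
    Polynomial.coeff_X_add_one_pow] at h
  rw [← h]
  refine Finset.sum_congr rfl fun U _ => congrArg (Polynomial.coeff · k) ?_
  exact Finset.prod_congr rfl fun i _ => by rw [Polynomial.C_sub, Polynomial.C_1, add_sub_assoc]

theorem sum_finrank_buildingCoeff (k : ℕ) :
    ∑ s, (-1 : ℤ) ^ s.card * (finrank F (buildingCoeff F V k s) : ℤ) =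
      chainSum (fun U : Submodule F V => ((finrank F U).choose k : ℤ)) ⊤ := by
  rw [chainSum, chainsBelow, Finset.sum_filter]
  refine Finset.sum_congr rfl fun s _ => ?_
  split_ifs with h
  · rw [buildingCoeff, orderCoeff_of_isChain h.1 h.2, finrank_extPow, top_inf_eq]
  · rw [buildingCoeff, orderCoeff, if_neg h, finrank_bot, Nat.cast_zero, mul_zero]

theorem neg_one_pow_mul_finrank_D {k : ℕ} (hk : k ≠ 0) (hkV : k < finrank F V) :
    (-1 : ℤ) ^ (finrank F V - k) * finrank F (D F V k) =
      chainSum (fun U : Submodule F V => ((finrank F U).choose k : ℤ)) ⊤ := by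
  have hexact : ExactBelow (buildingCoeff F V k) (finrank F V - k) := by
    simpa [intervalCoeff_bot_top] using
      exactBelow_intervalCoeff (disjoint_bot_left (a := (⊤ : Submodule F V))) k
  rw [finrank_D hk hkV, ← sum_finrank_buildingCoeff]
  exact ExactBelow.finrank_cycles_top (antitone_orderCoeff (extPow_mono k)) hexact
    fun s hs => buildingCoeff_eq_bot (by omega)

end Dimension

end Building

end

theorem theorem1p5 {F : Type*} [Field F] [Finite F]
    {V : Type*} [AddCommGroup V] [Module F V] [FiniteDimensional F V]
    (q n k : ℕ) (hq : Nat.card F = q) (hn : Module.finrank F V = n)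
    (hk : 1 ≤ k) (hkn : k < n) :
    (Module.finrank F (Building.D F V k) : ℤ) =
      ∑ α ∈ Finset.powersetCard (n - k) (Finset.Icc 1 (n - 1)),
        ∏ j ∈ α, ((q : ℤ) ^ j - 1) := by
  subst hq hn
  have : Finite V := Module.finite_of_finite F
  let _ := Fintype.ofFinite (Submodule F V)
  have hsum := Building.chainSum_choose (⊤ : Submodule F V) (finrank_top F V ▸ hkn.le)
  rw [finrank_top, ← Building.neg_one_pow_mul_finrank_D (Nat.one_le_iff_ne_zero.1 hk) hkn] at hsum
  exact mul_left_cancel₀ (pow_ne_zero _ (by norm_num)) hsum
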